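/- Let $p$ be a prime, $r\ge 1$, and let $S_1,\dots,S_N$ ($N\ge 0$) be a sequence over $\mathbb Z_{p^r}$. **Conventions.** $\mathcal A_p=\{0,1,\dots,p-1\}\subset\mathbb Z_{p^r}$, and $\mathcal A_p[x]$ is the set of polynomials with all coefficients in $\mathcal A_p$. A scalar has order $k$ if the additive subgroup it generates has $p^k$ elements. Monomials $x^\alpha e_i$ ($i\in\{1,2\}$) of row vectors in $\mathbb Z_{p^r}[x]^2$ are ordered by $x^\alpha e_i<x^\beta e_j$ iff $\alpha<\beta$, or $\alpha=\beta$ and $i<j$; if the leading term of $v\neq 0$ is $c\,x^\alpha e_i$, then $\operatorname{lm}(v)=x^\alpha e_i$, $\deg v=\alpha$, $\operatorname{lpos}(v)=i$, and $\operatorname{ord}(v)$ is the order of $c$. For a matrix with rows $v_1,\dots,v_{2r}$ write $v_j=[v_{j1}\;\;v_{j2}]$. A *feedback polynomial of length $L$* for $S_1,\dots,S_N$ is $\lambda=\lambda_0+\dots+\lambda_Lx^L$ with $\lambda_0$ a unit ($\lambda_L$ may be $0$) and $\lambda_0S_{L+j}+\sum_{i=1}^{L}\lambda_iS_{L+j-i}=0$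 for $j=1,\dots,N-L$. The least possible length is the *complexity* of the sequence, and a feedback polynomial of that length is called *shortest*. A *characteristic polynomial* is $d=d_Lx^L+\dots+d_0$ with $d_L$ a unit and $d_LS_{L+j}+\sum_{i=1}^{L}d_{L-i}S_{L+j-i}=0$ for $j=1,\dots,N-L$; it is *minimal* if its degree $L$ is least possible. A feedback polynomial of length $L$ for $S_1,\dots,S_N$ with $\lambda_L$ a unit (it is then also a characteristic polynomial of $S_N,\dots,S_1$) is called *bidirectional*. **Algorithm.** Start with the $2r\times 2$ matrix $R^0$ with rows $[x\;\,0],[px\;\,0],\dots,[p^{r-1}x\;\,0],[0\;\,1],[0\;\,p],\dots,[0\;\,p^{r-1}]$. For $k=1,\dots,N$, let $v_1,\dots,v_{2r}$ be the rows of $R^{k-1}$ and let $\Delta_i$ be the last entry of the trajectory $v_i(\sigma)\mathbf b_k$, where $\mathbf b_k=\left(\dots,\begin{bmatrix}0\\0\end{bmatrix},\begin{bmatrix}1\\0\end{bmatrix},\begin{bmatrix}0\\S_1\end{bmatrix},\dots,\begin{bmatrix}0\\S_k\end{bmatrix}\right)$ and $\sigma$ moves a trajectory one step to the right, dropping its last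 entry. For $\Delta_i\ne0$ write $\Delta_i=\theta_ip^{\ell_i-1}$ with $\theta_i$ a unit (any choice is allowed) and $1\le\ell_i\le r$. Put $P_0=\{i:\Delta_i=0\}$ and $P_j=\{i:\Delta_i\neq0,\ \ell_i=j\}$ for $1\le j\le r$, and let $i_j^\star$ be the largest index $i\in P_j$ for which $\operatorname{lm}(v_i)$ is minimal. With $e_i$ the unit row vectors of length $2r$, set $$E^k=\sum_{i\in P_0}e_i^Te_i+\sum_{j=1}^r\Big[\tfrac{x}{\theta_{i_j^\star}}e_j^Te_{i_j^\star}+e_{i_j^\star}^T(-\theta_{i_j^\star}e_j+\theta_je_{i_j^\star})+\sum_{i\in P_j\setminus\{j,i_j^\star\}}e_i^T(-\theta_ie_{i_j^\star}+\theta_{i_j^\star}e_i)\Big],\qquad R^k=E^kR^{k-1}.$$ The output is $R=R^N$. **Theorem.** The algorithm can always be carried out. For every possible output $R$, with rows $v_1,\dots,v_{2r}$, the following hold. 1. Let $L=\deg v_{r+1}$. The complexity of $S_1,\dots,S_N$ equals $L$, and $v_{(r+1)2}$ is a shortest feedback polynomial. The set of all shortest feedback polynomials is the set of all $$a\,v_{(r+1)2}+\sum_{j\ne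 r+1}a_jv_{j2},$$ with $0\neq a\in\mathcal A_p$ and, for $j\neq r+1$, $a_j\in\mathcal A_p[x]$ with $\deg a_j\le L-\deg v_j$ (so $a_j=0$ if $L<\deg v_j$). 2. There is exactly one index $j^\star$ with $\operatorname{lpos}(v_{j^\star})=2$ and $\operatorname{ord}(v_{j^\star})=r$. Let $\tilde L=\deg v_{j^\star}$. The complexity of the reciprocal sequence $S_N,\dots,S_1$ equals $\tilde L$, and $v_{j^\star2}$ is a minimal characteristic polynomial of $S_N,\dots,S_1$. The set of all minimal characteristic polynomials of $S_N,\dots,S_1$ is the set of all $$a\,v_{j^\star2}+\sum_{j\neq j^\star}a_jv_{j2},\qquad(\ast)$$ with $0\ne a\in\mathcal A_p$ and, for $j\neq j^\star$, $a_j\in\mathcal A_p[x]$ with $\deg a_j\le\tilde L-\deg v_j$. 3. If $j^\star=r+1$, then $v_{j^\star2}$ is bidirectional, and $(\ast)$ also gives exactly the set of all bidirectional minimal characteristic polynomials of $S_N,\dots,S_1$. If $j^\star\ne r+1$, then every polynomial $(\ast)$ whose parameters also satisfy $a_{r+1}(0)\ne0$ is a bidirectional minimal characteristic polynomial of $S_N,\dots,S_1$.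 -/

import Mathlib

open Polynomial

noncomputable section

/-! Row vectors of length two over `R[X]` and the term-over-position order.
The positions 1, 2 of a row vector are the indices `0, 1 : Fin 2`, and the monomial `x ^ α e_i` is
the element `toLex (α, i)` of the lexicographic product `ℕ ×ₗ Fin 2`. -/

section Vectors

variable {R : Type*} [CommRing R]

/-- The leading monomial in the TOP ordering (`⊥` for the zero vector). -/
def lm (v : Fin 2 → R[X]) : WithBot (ℕ ×ₗ Fin 2) :=
  Finset.univ.sup fun i : Fin 2 =>
    (v i).support.sup fun α => ((toLex (α, i) : ℕ ×ₗ Fin 2) : WithBot (ℕ ×ₗ Fin 2))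

/-- Degree and position of the leading monomial (the pair `(0, 0)` for the zero vector). -/
def leadPair (v : Fin 2 → R[X]) : ℕ × Fin 2 :=
  ofLex ((lm v).unbotD (toLex (0, 0)))

/-- The degree of a row vector with respect to the TOP ordering. -/
def topDeg (v : Fin 2 → R[X]) : ℕ := (leadPair v).1

/-- The leading position. -/
def lpos (v : Fin 2 → R[X]) : Fin 2 := (leadPair v).2

/-- The leading coefficient. -/
def lc (v : Fin 2 → R[X]) : R := (v (lpos v)).coeff (topDeg v)

/-- The scalar `a` has order `k`: the additive subgroup generated by `a` has `p ^ k` elements. -/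
def ScalarHasOrder (p k : ℕ) (a : R) : Prop :=
  Nat.card (AddSubgroup.zmultiples a) = p ^ k

/-- The nonzero vector `v` has order `k`: its leading coefficient has order `k`. -/
def HasOrder (p k : ℕ) (v : Fin 2 → R[X]) : Prop :=
  v ≠ 0 ∧ ScalarHasOrder p k (lc v)

/-! Sequences `S 1, …, S N`. A sequence is given by a function `S : ℕ → R` and its length `N`; the
values of `S` outside `{1, …, N}` are never used. -/

/-- `f` is a feedback polynomial of length `L` for `S 1, …, S N`. The coefficient of `x ^ L` may
be zero. -/
def IsFeedbackPoly (S : ℕ → R) (N L : ℕ) (f : R[X]) : Prop :=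
  f.natDegree ≤ L ∧ IsUnit (f.coeff 0) ∧
    ∀ j : ℕ, 1 ≤ j → L + j ≤ N →
      f.coeff 0 * S (L + j) + ∑ i ∈ Finset.Icc 1 L, f.coeff i * S (L + j - i) = 0

/-- The complexity: the shortest length of a feedback polynomial. -/
def complexity (S : ℕ → R) (N : ℕ) : ℕ :=
  sInf {L | ∃ f : R[X], IsFeedbackPoly S N L f}

/-- There is always a feedback polynomial, so that the infimum above is attained. -/
theorem exists_isFeedbackPoly_complexity (S : ℕ → R) (N : ℕ) :
    ∃ f : R[X], IsFeedbackPoly S N (complexity S N) f := by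
  have h : {L | ∃ f : R[X], IsFeedbackPoly S N L f}.Nonempty :=
    ⟨N, 1, by simp, by simp, fun j h1 h2 => by omega⟩
  exact Nat.sInf_mem h

/-- `f` is a shortest feedback polynomial for `S 1, …, S N`. -/
def IsShortestFeedbackPoly (S : ℕ → R) (N : ℕ) (f : R[X]) : Prop :=
  IsFeedbackPoly S N (complexity S N) f

/-- `d = d_L x ^ L + ⋯ + d_0` with `d_L` a unit is a characteristic polynomial of
`S 1, …, S N`. -/
def IsCharPoly (S : ℕ → R) (N : ℕ) (d : R[X]) : Prop :=
  IsUnit d.leadingCoeff ∧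
    ∀ j : ℕ, 1 ≤ j → d.natDegree + j ≤ N →
      d.leadingCoeff * S (d.natDegree + j) +
        ∑ i ∈ Finset.Icc 1 d.natDegree,
          d.coeff (d.natDegree - i) * S (d.natDegree + j - i) = 0

/-- A characteristic polynomial of least degree. -/
def IsMinCharPoly (S : ℕ → R) (N : ℕ) (d : R[X]) : Prop :=
  IsCharPoly S N d ∧ ∀ d' : R[X], IsCharPoly S N d' → d.natDegree ≤ d'.natDegree

/-- The reciprocal sequence `S N, …, S 1`. -/
def reciprocal (S : ℕ → R) (N : ℕ) : ℕ → R := fun i => S (N + 1 - i)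

/-- `f` is bidirectional for `S 1, …, S N`: for some `L` it is a feedback polynomial of length `L`
whose coefficient of `x ^ L` is a unit. -/
def IsBidirectional (S : ℕ → R) (N : ℕ) (f : R[X]) : Prop :=
  ∃ L : ℕ, IsFeedbackPoly S N L f ∧ IsUnit (f.coeff L)

/-! Trajectories. A trajectory on the negative time axis is a function `b : ℕ → Fin 2 → R`, where
`b m` is the value `m` time units before the last one. -/

/-- The forward shift `σ`, which moves a trajectory one step to the right and drops its last
value. -/
def shift (b : ℕ → Fin 2 → R) : ℕ → Fin 2 → R := fun m => b (m + 1)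

/-- The trajectory `(…, (0, 0), (1, 0), (0, S 1), (0, S 2), …, (0, S N))`. -/
def dataTraj (S : ℕ → R) (N : ℕ) : ℕ → Fin 2 → R := fun m =>
  if m < N then ![0, S (N - m)] else if m = N then ![1, 0] else 0

/-- The scalar trajectory `v(σ) b`. -/
def applyShift (v : Fin 2 → R[X]) (b : ℕ → Fin 2 → R) : ℕ → R := fun m =>
  ∑ c : Fin 2, (v c).sum fun α a => a * (shift^[α] b) m c

end Vectors

/-! The algorithm over `ZMod (p ^ r)`. The row indices `1, …, 2r` are the elements `0, …, 2r - 1` of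
`Fin (2 * r)`, and the indices `1, …, r` of the classes `P_j` are the elements of `Fin r`. -/

section Algorithm

variable {p r : ℕ}

/-- The row index `j ∈ {1, …, r}`. -/
def lowRow (j : Fin r) : Fin (2 * r) := ⟨j.1, by have := j.2; omega⟩

/-- The row index `r + 1`. -/
def midRow (hr : 0 < r) : Fin (2 * r) := ⟨r, by omega⟩

/-- The initial matrix `R^0`. -/
def initMatrix (p r : ℕ) : Matrix (Fin (2 * r)) (Fin 2) (ZMod (p ^ r))[X] := fun i =>
  if i.1 < r then ![C ((p : ZMod (p ^ r)) ^ i.1) * X, 0]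
  else ![0, C ((p : ZMod (p ^ r)) ^ (i.1 - r))]

/-- The column `Δ^k`: the last values of the error trajectory `R^{k-1}(σ) b_k`, where
`b_k = σ ^ (N - k) b`. -/
def discrepancy (S : ℕ → ZMod (p ^ r)) (N k : ℕ)
    (V : Matrix (Fin (2 * r)) (Fin 2) (ZMod (p ^ r))[X]) (i : Fin (2 * r)) : ZMod (p ^ r) :=
  applyShift (V i) (shift^[N - k] (dataTraj S N)) 0

/-- The class `P_j`, where `e i = ℓ_i - 1` is the exponent of `p` in `Δ_i ≠ 0`. -/
def classP (Δ : Fin (2 * r) → ZMod (p ^ r)) (e : Fin (2 * r) → Fin r) (j : Fin r) :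
    Finset (Fin (2 * r)) :=
  Finset.univ.filter fun i => Δ i ≠ 0 ∧ e i = j

/-- The update matrix `E^k`. -/
def updateMatrix (Δ : Fin (2 * r) → ZMod (p ^ r)) (θ : Fin (2 * r) → (ZMod (p ^ r))ˣ)
    (e : Fin (2 * r) → Fin r) (istar : Fin r → Fin (2 * r)) :
    Matrix (Fin (2 * r)) (Fin (2 * r)) (ZMod (p ^ r))[X] :=
  ∑ i ∈ Finset.univ.filter (fun i => Δ i = 0), Matrix.single i i 1 +
  ∑ j : Fin r,
    (Matrix.single (lowRow j) (istar j) (C (((θ (istar j))⁻¹ : (ZMod (p ^ r))ˣ) : ZMod (p ^ r)) * X) +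
      (Matrix.single (istar j) (lowRow j) (-C (θ (istar j) : ZMod (p ^ r))) +
        Matrix.single (istar j) (istar j) (C (θ (lowRow j) : ZMod (p ^ r)))) +
      ∑ i ∈ classP Δ e j \ {lowRow j, istar j},
        (Matrix.single i (istar j) (-C (θ i : ZMod (p ^ r))) +
          Matrix.single i i (C (θ (istar j) : ZMod (p ^ r)))))

/-- One step of the algorithm, from `V = R^{k-1}` to `V' = R^k`. The units `θ_i` with
`Δ_i = θ_i p ^ (ℓ_i - 1)` are not unique; every choice is allowed. -/
def IsStep (S : ℕ → ZMod (p ^ r)) (N k : ℕ)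
    (V V' : Matrix (Fin (2 * r)) (Fin 2) (ZMod (p ^ r))[X]) : Prop :=
  ∃ (θ : Fin (2 * r) → (ZMod (p ^ r))ˣ) (e : Fin (2 * r) → Fin r) (istar : Fin r → Fin (2 * r)),
    (∀ i, discrepancy S N k V i ≠ 0 →
      discrepancy S N k V i = (θ i : ZMod (p ^ r)) * (p : ZMod (p ^ r)) ^ (e i).1) ∧
    (∀ j, istar j ∈ classP (discrepancy S N k V) e j ∧
      ∀ i ∈ classP (discrepancy S N k V) e j,
        lm (V (istar j)) ≤ lm (V i) ∧ (lm (V i) = lm (V (istar j)) → i ≤ istar j)) ∧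
    V' = updateMatrix (discrepancy S N k V) θ e istar * V

/-- `V` is a possible value of `R^k` in a run of the algorithm on `S 1, …, S N`. -/
inductive IsState (S : ℕ → ZMod (p ^ r)) (N : ℕ) :
    ℕ → Matrix (Fin (2 * r)) (Fin 2) (ZMod (p ^ r))[X] → Prop
  | init : IsState S N 0 (initMatrix p r)
  | step (k : ℕ) (V V' : Matrix (Fin (2 * r)) (Fin 2) (ZMod (p ^ r))[X]) :
      k < N → IsState S N k V → IsStep S N (k + 1) V V' → IsState S N (k + 1) V'

/-- `V` is an output `R = R^N` of the algorithm applied to `S 1, …, S N`. -/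
def IsOutput (S : ℕ → ZMod (p ^ r)) (N : ℕ)
    (V : Matrix (Fin (2 * r)) (Fin 2) (ZMod (p ^ r))[X]) : Prop :=
  IsState S N N V

/-- The set of digits `A_p = {0, 1, …, p - 1}` in `ZMod (p ^ r)`. -/
def digits (p r : ℕ) : Set (ZMod (p ^ r)) := {a | ∃ n : ℕ, n < p ∧ a = (n : ZMod (p ^ r))}

/-- The admissible parameters: `0 ≠ a ∈ A_p`, and for `j ≠ m` the polynomial `c j` lies in `A_p[x]`
and has `deg (c j) ≤ deg (v_m) - deg (v_j)` (so `c j = 0` if the right side is negative). -/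
def IsAdmissible (V : Matrix (Fin (2 * r)) (Fin 2) (ZMod (p ^ r))[X]) (m : Fin (2 * r))
    (a : ZMod (p ^ r)) (c : Fin (2 * r) → (ZMod (p ^ r))[X]) : Prop :=
  (a ∈ digits p r ∧ a ≠ 0) ∧
    ∀ j, j ≠ m → (∀ n, (c j).coeff n ∈ digits p r) ∧
      (c j ≠ 0 → (c j).natDegree + topDeg (V j) ≤ topDeg (V m))

/-- The polynomial `a v_{m2} + ∑_{j ≠ m} c_j v_{j2}`. -/
def paramPoly (V : Matrix (Fin (2 * r)) (Fin 2) (ZMod (p ^ r))[X]) (m : Fin (2 * r))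
    (a : ZMod (p ^ r)) (c : Fin (2 * r) → (ZMod (p ^ r))[X]) : (ZMod (p ^ r))[X] :=
  C a * V m 1 + ∑ j ∈ Finset.univ.erase m, c j * V j 1

/-- The set of polynomials described by the parametrization based on row `m`. -/
def paramSet (V : Matrix (Fin (2 * r)) (Fin 2) (ZMod (p ^ r))[X]) (m : Fin (2 * r)) :
    Set (ZMod (p ^ r))[X] :=
  {f | ∃ a c, IsAdmissible V m a c ∧ f = paramPoly V m a c}

end Algorithm

end

/-! Give a nonzero row vector with leading monomial `x ^ α e_i` (`i = 0, 1`) and order `s` the key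
`r * (2 * α + i) + (s - 1)`. Keys order vectors first by leading monomial, then by order.
Multiplication by `x` adds `2 * r` to the key, and multiplication by `p` lowers it. Vectors of key
below `K` form a submodule over the scalars, and two vectors of the same key differ, up to a digit
in `A_p`, by a vector of smaller key (`HasKey.exists_digit`).

Let `M_k` be the `x`-stable module of row vectors whose error vanishes on `S 1, …, S k`. The
algorithm maintains `2 * r` rows of `M_k` whose keys are pairwise incongruent modulo `2 * r` and
account, up to adding multiples of `2 * r`, for every key occurring in `M_k` (`IsKeyed`). Division
then expands each element of `M_k` in these rows with digit coefficients and no term of larger key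
(`IsKeyed.exists_expansion`).

The error at time `k + 1` is a functional on `M_k` that kills `x M_k`, so only the constant terms of
the expansion matter. Hence, among rows with error of exact exponent `j`, the one with least leading
monomial is unique, and no row of smaller key has an error of exponent at most `j`
(`IsKeyed.exists_least`). Passing to `M_{k+1}` removes exactly the keys of these `r` pivots. The
update moves each pivot, times `x`, into row `j` and lets the old key of row `j` take the pivot's
place. The other invariants are that rows `1, …, r` have error `p ^ (j - 1)` at the next time and
second entry without constant term, and that row `r + j` has second entry with constant term of
exact exponent `j - 1` (`IsLoopInvariant.step`).

At the end, linear recurrences of length `L` are the second entries of elements of `M_N` of degree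
at most `L` (`isRecurrence_iff`). Modulo `p`, only row `r + 1` contributes to the constant term,
which governs feedback polynomials. Only the row with key congruent to `-1` modulo `2 * r` can make
the coefficient of `x ^ L` a unit at the minimal `L`, which governs characteristic polynomials of
the reciprocal sequence. Both parametrizations are then read off the expansion. -/

noncomputable section

/-! ### Divisibility by powers of `p` in `ZMod (p ^ r)`. -/

section PrimePower

theorem ZMod.prime_pow_eq_zero {p r : ℕ} : (p : ZMod (p ^ r)) ^ r = 0 := by
  rw [← Nat.cast_pow, ZMod.natCast_self]

theorem ZMod.prime_pow_eq_zero_of_le {p r s : ℕ} (h : r ≤ s) : (p : ZMod (p ^ r)) ^ s = 0 :=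
  pow_eq_zero_of_le h ZMod.prime_pow_eq_zero

variable {p r : ℕ} [hp : Fact p.Prime]

theorem ZMod.isUnit_or_prime_dvd (a : ZMod (p ^ r)) : IsUnit a ∨ (p : ZMod (p ^ r)) ∣ a := by
  have : NeZero (p ^ r) := ⟨pow_ne_zero _ hp.out.ne_zero⟩
  obtain ⟨n, rfl⟩ := ZMod.natCast_zmod_surjective a
  by_cases h : p ∣ n
  · exact Or.inr (Nat.cast_dvd_cast h)
  · refine Or.inl ((ZMod.isUnit_iff_coprime _ _).2 ?_)
    exact (((Nat.Prime.coprime_iff_not_dvd hp.out).2 h).symm).pow_right r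

theorem ZMod.prime_pow_dvd_natCast_iff {j n : ℕ} (hj : j ≤ r) :
    (p : ZMod (p ^ r)) ^ j ∣ (n : ZMod (p ^ r)) ↔ p ^ j ∣ n := by
  have : NeZero (p ^ r) := ⟨pow_ne_zero _ hp.out.ne_zero⟩
  constructor
  · rintro ⟨b, hb⟩
    obtain ⟨m, rfl⟩ := ZMod.natCast_zmod_surjective b
    rw [← Nat.cast_pow, ← Nat.cast_mul, ZMod.natCast_eq_natCast_iff] at hb
    exact (hb.dvd_iff (pow_dvd_pow p hj)).2 (dvd_mul_right _ _)
  · intro h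
    rw [← Nat.cast_pow]
    exact Nat.cast_dvd_cast h

/-- Cancellation by `p ^ t` is safe despite zero divisors: up to exponent `r`, divisibility by a
power of `p` can be tested on integer representatives. -/
theorem ZMod.prime_pow_mul_dvd {t j : ℕ} (h : t + j ≤ r) {a : ZMod (p ^ r)}
    (ha : (p : ZMod (p ^ r)) ^ (t + j) ∣ (p : ZMod (p ^ r)) ^ t * a) :
    (p : ZMod (p ^ r)) ^ j ∣ a := by
  have : NeZero (p ^ r) := ⟨pow_ne_zero _ hp.out.ne_zero⟩
  obtain ⟨n, rfl⟩ := ZMod.natCast_zmod_surjective a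
  rw [← Nat.cast_pow p t, ← Nat.cast_mul, ZMod.prime_pow_dvd_natCast_iff h, pow_add] at ha
  rw [ZMod.prime_pow_dvd_natCast_iff (by omega)]
  exact Nat.dvd_of_mul_dvd_mul_left (pow_pos hp.out.pos _) ha

theorem ZMod.not_prime_pow_dvd {j : ℕ} (hj : j < r) {u : ZMod (p ^ r)} (hu : IsUnit u) :
    ¬ (p : ZMod (p ^ r)) ^ (j + 1) ∣ u * (p : ZMod (p ^ r)) ^ j := by
  intro h
  rw [hu.dvd_mul_left, ← Nat.cast_pow p j, ZMod.prime_pow_dvd_natCast_iff hj,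
    Nat.pow_dvd_pow_iff_le_right hp.out.one_lt] at h
  omega

theorem ZMod.exists_unit_mul_prime_pow {j : ℕ} {a : ZMod (p ^ r)}
    (h : (p : ZMod (p ^ r)) ^ j ∣ a) (h' : ¬ (p : ZMod (p ^ r)) ^ (j + 1) ∣ a) :
    ∃ u : (ZMod (p ^ r))ˣ, a = u * (p : ZMod (p ^ r)) ^ j := by
  obtain ⟨b, rfl⟩ := h
  rcases ZMod.isUnit_or_prime_dvd b with ⟨u, rfl⟩ | hb
  · exact ⟨u, mul_comm _ _⟩
  · exact absurd (by rw [pow_succ]; exact mul_dvd_mul_left _ hb) h'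

theorem ZMod.exists_eq_unit_mul_prime_pow {a : ZMod (p ^ r)} (ha : a ≠ 0) :
    ∃ (u : (ZMod (p ^ r))ˣ) (j : Fin r), a = u * (p : ZMod (p ^ r)) ^ (j : ℕ) := by
  classical
  have h : ∃ j, ¬ (p : ZMod (p ^ r)) ^ (j + 1) ∣ a :=
    ⟨r, fun h => ha (by
      rwa [ZMod.prime_pow_eq_zero_of_le (Nat.le_succ r), zero_dvd_iff] at h)⟩
  have hd : (p : ZMod (p ^ r)) ^ (Nat.find h) ∣ a := by
    rcases Nat.eq_zero_or_pos (Nat.find h) with h0 | h0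
    · rw [h0, pow_zero]; exact one_dvd _
    · have := Nat.find_min h (m := Nat.find h - 1) (by omega)
      rwa [not_not, Nat.sub_add_cancel h0] at this
  obtain ⟨u, hu⟩ := ZMod.exists_unit_mul_prime_pow hd (Nat.find_spec h)
  refine ⟨u, ⟨Nat.find h, ?_⟩, hu⟩
  by_contra hr
  rw [ZMod.prime_pow_eq_zero_of_le (not_lt.1 hr), mul_zero] at hu
  exact ha hu

/-- The socle of `ZMod (p ^ r)` is one-dimensional over the residue field. -/
theorem ZMod.exists_digit_mul {a b : ZMod (p ^ r)} (ha : a ≠ 0) (hpa : (p : ZMod (p ^ r)) * a = 0)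
    (hpb : (p : ZMod (p ^ r)) * b = 0) : ∃ n : ℕ, n < p ∧ b = n * a := by
  have : NeZero (p ^ r) := ⟨pow_ne_zero _ hp.out.ne_zero⟩
  obtain ⟨u, j, rfl⟩ := ZMod.exists_eq_unit_mul_prime_pow ha
  have hj : (j : ℕ) + 1 = r := by
    by_contra hne
    have hlt : (j : ℕ) + 1 < r := by have := j.2; omega
    refine ZMod.not_prime_pow_dvd hlt u.isUnit ?_
    have : (u : ZMod (p ^ r)) * (p : ZMod (p ^ r)) ^ ((j : ℕ) + 1) = 0 := by rw [← hpa]; ring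
    rw [this]
    exact dvd_zero _
  have hb : (p : ZMod (p ^ r)) ^ (j : ℕ) ∣ b := by
    refine ZMod.prime_pow_mul_dvd (t := 1) (by omega) ?_
    rw [pow_one, hpb]
    exact dvd_zero _
  obtain ⟨w, rfl⟩ := hb
  obtain ⟨n, hn⟩ := ZMod.natCast_zmod_surjective (w * ((u⁻¹ : (ZMod (p ^ r))ˣ) : ZMod (p ^ r)))
  refine ⟨n % p, Nat.mod_lt _ hp.out.pos, ?_⟩
  have hw : w = n * u := by rw [hn, mul_assoc, Units.inv_mul, mul_one]
  have hpp : (p : ZMod (p ^ r)) * (p : ZMod (p ^ r)) ^ (j : ℕ) = 0 := by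
    rw [← pow_succ', hj, ZMod.prime_pow_eq_zero]
  have hn' : (n : ZMod (p ^ r)) = (n % p : ℕ) + p * (n / p : ℕ) := by
    rw [← Nat.cast_mul, ← Nat.cast_add, Nat.mod_add_div]
  rw [hw, hn']
  linear_combination (u : ZMod (p ^ r)) * ((n / p : ℕ) : ZMod (p ^ r)) * hpp

theorem ZMod.isUnit_natCast_of_lt {n : ℕ} (h0 : n ≠ 0) (hn : n < p) :
    IsUnit (n : ZMod (p ^ r)) := by
  rw [ZMod.isUnit_iff_coprime]
  exact (Nat.coprime_of_lt_prime h0 hn hp.out).symm.pow_right r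

theorem isUnit_of_mem_digits {a : ZMod (p ^ r)} (ha : a ∈ digits p r) (h0 : a ≠ 0) : IsUnit a := by
  obtain ⟨n, hn, rfl⟩ := ha
  exact ZMod.isUnit_natCast_of_lt (by rintro rfl; simp at h0) hn

theorem zero_mem_digits : (0 : ZMod (p ^ r)) ∈ digits p r := ⟨0, hp.out.pos, by simp⟩

/-- The nonunits are the multiples of `p`, and these are what `p ^ (r - 1)` kills. This is the form
in which the key filtration detects units. -/
theorem ZMod.isUnit_iff_prime_pow_mul_ne_zero (hr : 0 < r) {a : ZMod (p ^ r)} :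
    IsUnit a ↔ (p : ZMod (p ^ r)) ^ (r - 1) * a ≠ 0 := by
  constructor
  · rintro ha h
    refine ZMod.not_prime_pow_dvd (j := r - 1) (by omega) ha ?_
    rw [mul_comm, h]
    exact dvd_zero _
  · intro h
    refine (ZMod.isUnit_or_prime_dvd a).resolve_right ?_
    rintro ⟨b, rfl⟩
    rw [← mul_assoc, ← pow_succ, Nat.sub_add_cancel hr, ZMod.prime_pow_eq_zero, zero_mul] at h
    exact h rfl

theorem scalarHasOrder_iff_isUnit (hr : 0 < r) {a : ZMod (p ^ r)} :
    ScalarHasOrder p r a ↔ IsUnit a := by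
  rw [ScalarHasOrder, Nat.card_zmultiples, ZMod.isUnit_iff_prime_pow_mul_ne_zero hr]
  have h1 : p ^ r • a = 0 := by
    rw [nsmul_eq_mul, Nat.cast_pow, ZMod.prime_pow_eq_zero, zero_mul]
  constructor
  · intro h h0
    have : p ^ (r - 1) • a = 0 := by rw [nsmul_eq_mul, Nat.cast_pow, h0]
    have := addOrderOf_dvd_of_nsmul_eq_zero this
    rw [h, Nat.pow_dvd_pow_iff_le_right hp.out.one_lt] at this
    omega
  · intro h
    obtain ⟨k, rfl⟩ : ∃ k, r = k + 1 := ⟨r - 1, by omega⟩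
    refine addOrderOf_eq_prime_pow ?_ h1
    rwa [nsmul_eq_mul, Nat.cast_pow]

end PrimePower

/-! ### The filtration of row vectors by leading monomial and order. -/

section Keys

variable {p r : ℕ}

/-- The row vectors whose leading monomial `x ^ α e_i` and whose order `s` satisfy
`r * (2 * α + i) + s ≤ K`. The subtraction is truncated. -/
def below (p r K : ℕ) : Submodule (ZMod (p ^ r)) (Fin 2 → (ZMod (p ^ r))[X]) where
  carrier := {v | ∀ (i : Fin 2) (α : ℕ),
    (p : ZMod (p ^ r)) ^ (K - r * (2 * α + i)) * (v i).coeff α = 0}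
  add_mem' hv hw i α := by
    rw [Pi.add_apply, coeff_add, mul_add, hv, hw, add_zero]
  zero_mem' i α := by simp
  smul_mem' a v hv i α := by
    rw [Pi.smul_apply, coeff_smul, smul_eq_mul, mul_left_comm, hv, mul_zero]

theorem mem_below {K : ℕ} {v : Fin 2 → (ZMod (p ^ r))[X]} :
    v ∈ below p r K ↔ ∀ (i : Fin 2) (α : ℕ),
      (p : ZMod (p ^ r)) ^ (K - r * (2 * α + i)) * (v i).coeff α = 0 := Iff.rfl

theorem below_mono {K K' : ℕ} (h : K ≤ K') : below p r K ≤ below p r K' := by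
  intro v hv i α
  obtain ⟨d, hd⟩ := Nat.exists_eq_add_of_le
    (show K - r * (2 * α + (i : ℕ)) ≤ K' - r * (2 * α + (i : ℕ)) by omega)
  rw [hd, pow_add, mul_right_comm, hv i α, zero_mul]

theorem mem_below_zero {v : Fin 2 → (ZMod (p ^ r))[X]} : v ∈ below p r 0 ↔ v = 0 := by
  constructor
  · intro h
    ext i α
    simpa using h i α
  · rintro rfl
    exact Submodule.zero_mem _

/-- At multiples of `r` the filtration only restricts which monomials occur: for smaller monomials
the exponent is at least `r`, so the condition is empty. -/
theorem mem_below_mul_iff {n : ℕ} {v : Fin 2 → (ZMod (p ^ r))[X]} :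
    v ∈ below p r (r * n) ↔ ∀ (i : Fin 2) (α : ℕ), n ≤ 2 * α + i → (v i).coeff α = 0 := by
  constructor
  · intro h i α hn
    have := h i α
    rwa [Nat.sub_eq_zero_of_le (Nat.mul_le_mul_left r hn), pow_zero, one_mul] at this
  · intro h i α
    rcases le_or_gt n (2 * α + i) with hn | hn
    · rw [h i α hn, mul_zero]
    · rw [ZMod.prime_pow_eq_zero_of_le, zero_mul]
      rw [← Nat.mul_sub]
      exact Nat.le_mul_of_pos_right r (by omega)

theorem mem_below_smul {K t : ℕ} {v : Fin 2 → (ZMod (p ^ r))[X]} (hv : v ∈ below p r (K + t)) :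
    (p : ZMod (p ^ r)) ^ t • v ∈ below p r K := by
  intro i α
  rw [Pi.smul_apply, coeff_smul, smul_eq_mul, ← mul_assoc, ← pow_add]
  rcases le_total (r * (2 * α + i)) K with h | h
  · rw [← hv i α]
    congr 2
    omega
  · obtain ⟨d, hd⟩ := Nat.exists_eq_add_of_le
      (show K + t - r * (2 * α + (i : ℕ)) ≤ K - r * (2 * α + (i : ℕ)) + t by omega)
    rw [hd, pow_add, mul_right_comm, hv i α, zero_mul]

theorem X_pow_smul_mem_below {K t : ℕ} {v : Fin 2 → (ZMod (p ^ r))[X]} :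
    (X ^ t : (ZMod (p ^ r))[X]) • v ∈ below p r (K + 2 * r * t) ↔ v ∈ below p r K := by
  have key : ∀ α i, K + 2 * r * t - r * (2 * (α + t) + i) = K - r * (2 * α + i) := by
    intro α i
    have : r * (2 * (α + t) + i) = r * (2 * α + i) + 2 * r * t := by ring
    omega
  constructor
  · intro h i α
    have := h i (α + t)
    rwa [Pi.smul_apply, smul_eq_mul, coeff_X_pow_mul, key] at this
  · intro h i α
    rw [Pi.smul_apply, smul_eq_mul, coeff_X_pow_mul']
    split_ifs with hα
    · obtain ⟨d, rfl⟩ := Nat.exists_eq_add_of_le hα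
      rw [Nat.add_sub_cancel_left, add_comm t d, key]
      exact h i d
    · exact mul_zero _

/-- The key `r * (2 * α + i) + (s - 1)` of a row vector with leading monomial `x ^ α e_i` and
order `s`. -/
def HasKey (v : Fin 2 → (ZMod (p ^ r))[X]) (K : ℕ) : Prop :=
  v ∈ below p r (K + 1) ∧ v ∉ below p r K

namespace HasKey

variable {v w : Fin 2 → (ZMod (p ^ r))[X]} {K : ℕ}

theorem ne_zero (h : HasKey v K) : v ≠ 0 := by
  rintro rfl
  exact h.2 (Submodule.zero_mem _)

theorem X_pow_smul (h : HasKey v K) (t : ℕ) :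
    HasKey ((X ^ t : (ZMod (p ^ r))[X]) • v) (K + 2 * r * t) := by
  refine ⟨?_, fun h' => h.2 (X_pow_smul_mem_below.1 h')⟩
  rw [add_right_comm]
  exact X_pow_smul_mem_below.2 h.1

theorem unit_smul (h : HasKey v K) {a : ZMod (p ^ r)} (ha : IsUnit a) : HasKey (a • v) K := by
  obtain ⟨u, rfl⟩ := ha
  refine ⟨Submodule.smul_mem _ _ h.1, fun h' => h.2 ?_⟩
  have := Submodule.smul_mem _ ((u⁻¹ : (ZMod (p ^ r))ˣ) : ZMod (p ^ r)) h'
  rwa [smul_smul, Units.inv_mul, one_smul] at this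

theorem add_mem (h : HasKey v K) (hw : w ∈ below p r K) : HasKey (v + w) K :=
  ⟨Submodule.add_mem _ h.1 (below_mono (Nat.le_succ K) hw),
    fun h' => h.2 ((Submodule.add_mem_iff_left _ hw).1 h')⟩

/-- A coefficient that violates the bound for `K` but not for `K + 1` needs an exponent `K - r * (2
* α + i)` that is not truncated and is less than `r`. So `K / r` encodes the leading monomial and `K
% r` the order minus one. -/
theorem lead (h : HasKey v K) : ∃ (i : Fin 2) (α : ℕ), K / r = 2 * α + i ∧
    (p : ZMod (p ^ r)) ^ (K % r) * (v i).coeff α ≠ 0 := by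
  have h2 := h.2
  simp only [mem_below, not_forall] at h2
  obtain ⟨i, α, hα⟩ := h2
  refine ⟨i, α, ?_⟩
  have h3 : K - r * (2 * α + i) < r := by
    by_contra hlt
    exact hα (by rw [ZMod.prime_pow_eq_zero_of_le (not_lt.1 hlt), zero_mul])
  have h4 : r * (2 * α + i) ≤ K := by
    by_contra hlt
    refine hα ?_
    have := h.1 i α
    rw [Nat.sub_eq_zero_of_le (by omega)] at this ⊢
    exact this
  have hdiv : K / r = 2 * α + i := by
    rw [Nat.div_eq_iff (by omega), mul_comm]
    omega
  refine ⟨hdiv, ?_⟩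
  rwa [Nat.mod_eq_sub, hdiv]

theorem coeff_eq_zero (h : HasKey v K) (hr : 0 < r) (i : Fin 2) (α : ℕ) (hα : K / r < 2 * α + i) :
    (v i).coeff α = 0 := by
  have := h.1 i α
  rwa [Nat.sub_eq_zero_of_le, pow_zero, one_mul] at this
  rw [Nat.div_lt_iff_lt_mul hr, mul_comm] at hα
  exact hα

/-- As long as no multiple of `r` is crossed, the leading monomial survives and each factor `p`
lowers the order by exactly one. -/
theorem prime_pow_smul {t : ℕ} (h : HasKey v (K + t)) (hK : (K + t) / r = K / r) :
    HasKey ((p : ZMod (p ^ r)) ^ t • v) K := by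
  refine ⟨mem_below_smul (by rw [add_right_comm]; exact h.1), fun h' => ?_⟩
  obtain ⟨i, α, h1, h2⟩ := h.lead
  refine h2 ?_
  have := h' i α
  rw [Pi.smul_apply, coeff_smul, smul_eq_mul, ← mul_assoc, ← pow_add, ← h1, hK] at this
  rw [← this, Nat.mod_eq_sub, hK]
  congr 2
  have := Nat.mul_div_le K r
  omega

theorem lm_eq (h : HasKey v K) (hr : 0 < r) : ∃ (i : Fin 2) (α : ℕ), K / r = 2 * α + i ∧
    (p : ZMod (p ^ r)) ^ (K % r) * (v i).coeff α ≠ 0 ∧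
    lm v = ((toLex (α, i) : ℕ ×ₗ Fin 2) : WithBot (ℕ ×ₗ Fin 2)) := by
  obtain ⟨i, α, h1, h2⟩ := h.lead
  refine ⟨i, α, h1, h2, le_antisymm ?_ ?_⟩
  · refine Finset.sup_le fun i' _ => Finset.sup_le fun α' hα' => ?_
    have hle : 2 * α' + (i' : ℕ) ≤ 2 * α + i := by
      rw [← h1]
      by_contra hlt
      exact mem_support_iff.1 hα' (h.coeff_eq_zero hr i' α' (not_le.1 hlt))
    rw [WithBot.coe_le_coe, Prod.Lex.toLex_le_toLex]
    have := i.2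
    have := i'.2
    simp only [Fin.le_def]
    omega
  · have hmem : α ∈ (v i).support :=
      mem_support_iff.2 fun h0 => h2 (by rw [h0, mul_zero])
    exact (Finset.le_sup (f := fun α => ((toLex (α, i) : ℕ ×ₗ Fin 2) : WithBot (ℕ ×ₗ Fin 2)))
      hmem).trans (Finset.le_sup (f := fun i : Fin 2 => (v i).support.sup fun α =>
        ((toLex (α, i) : ℕ ×ₗ Fin 2) : WithBot (ℕ ×ₗ Fin 2))) (Finset.mem_univ i))

theorem leadPair_eq (h : HasKey v K) (hr : 0 < r) :
    K / r = 2 * topDeg v + lpos v ∧ (p : ZMod (p ^ r)) ^ (K % r) * lc v ≠ 0 := by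
  obtain ⟨i, α, h1, h2, h3⟩ := h.lm_eq hr
  have : leadPair v = (α, i) := by
    rw [leadPair, h3]
    rfl
  rw [lc, lpos, topDeg, this]
  exact ⟨h1, h2⟩

theorem topDeg_eq (h : HasKey v K) (hr : 0 < r) : topDeg v = K / (2 * r) := by
  have := (h.leadPair_eq hr).1
  have h2 := (lpos v).2
  rw [mul_comm, ← Nat.div_div_eq_div_mul]
  omega

theorem lm_le_lm_iff (h : HasKey v K) {K' : ℕ} (h' : HasKey w K') (hr : 0 < r) :
    lm v ≤ lm w ↔ K / r ≤ K' / r := by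
  obtain ⟨i, α, h1, -, h3⟩ := h.lm_eq hr
  obtain ⟨i', α', h1', -, h3'⟩ := h'.lm_eq hr
  rw [h3, h3', WithBot.coe_le_coe, Prod.Lex.toLex_le_toLex, h1, h1']
  have := i.2
  have := i'.2
  simp only [Fin.le_def]
  omega

variable [hp : Fact p.Prime]

/-- Modulo `2 * r` the degree drops out of the key, leaving position and order; the last residue
means position 2 and full order. -/
theorem mod_eq (h : HasKey v K) (hr : 0 < r) :
    K % (2 * r) = 2 * r - 1 ↔ lpos v = 1 ∧ HasOrder p r v := by
  have hl := h.leadPair_eq hr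
  have h2 := (lpos v).2
  have hpos : lpos v = 1 ↔ (lpos v : ℕ) = 1 := by rw [Fin.ext_iff]; rfl
  have hmod : K % (2 * r) = K % r + r * (lpos v : ℕ) := by
    rw [mul_comm 2 r, Nat.mod_mul]
    congr 2
    omega
  have hlt := Nat.mod_lt K hr
  have hord : HasOrder p r v ↔ K % r = r - 1 := by
    rw [HasOrder, scalarHasOrder_iff_isUnit hr, ZMod.isUnit_iff_prime_pow_mul_ne_zero hr]
    constructor
    · rintro ⟨-, hlc⟩
      by_contra hne
      refine hlc ?_
      have h4 := h.1 (lpos v) (topDeg v)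
      rw [← hl.1] at h4
      have := Nat.div_add_mod K r
      obtain ⟨d, hd⟩ := Nat.exists_eq_add_of_le (show K + 1 - r * (K / r) ≤ r - 1 by omega)
      rw [hd, pow_add, mul_right_comm, lc, h4, zero_mul]
    · intro hK
      exact ⟨h.ne_zero, hK ▸ hl.2⟩
  rw [hpos, hord, hmod]
  rcases Nat.lt_or_ge (lpos v : ℕ) 1 with h1 | h1
  · have : (lpos v : ℕ) = 0 := by omega
    rw [this]
    omega
  · have : (lpos v : ℕ) = 1 := by omega
    rw [this]
    omega

/-- The leading coefficients, scaled by `p ^ (K % r)`, both lie in the one-dimensional socle, so a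
digit multiple of `v` cancels the top layer of `w`. -/
theorem exists_digit (h : HasKey v K) (hw : w ∈ below p r (K + 1)) :
    ∃ a ∈ digits p r, w - a • v ∈ below p r K := by
  obtain ⟨i, α, h1, h2⟩ := h.lead
  have hb : ∀ u ∈ below p r (K + 1), (p : ZMod (p ^ r)) * ((p : ZMod (p ^ r)) ^ (K % r) *
      (u i).coeff α) = 0 := by
    intro u hu
    have := hu i α
    have h3 := Nat.div_add_mod K r
    rw [← h1, show K + 1 - r * (K / r) = K % r + 1 by omega, pow_succ'] at this
    rw [← this]
    ring
  obtain ⟨n, hn, hnw⟩ := ZMod.exists_digit_mul h2 (hb v h.1) (hb w hw)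
  refine ⟨n, ⟨n, hn, rfl⟩, fun i' α' => ?_⟩
  have hmem := Submodule.sub_mem _ hw (Submodule.smul_mem _ (n : ZMod (p ^ r)) h.1) i' α'
  -- Below the leading monomial the exponent is at least `r` and nothing is required; above it the
  -- exponent is truncated to zero for both `K` and `K + 1`.
  rcases lt_trichotomy (2 * α' + (i' : ℕ)) (2 * α + i) with hlt | heq | hlt
  · rw [ZMod.prime_pow_eq_zero_of_le, zero_mul]
    rw [← h1] at hlt
    have h3 := Nat.div_add_mod K r
    have : r * (2 * α' + i' + 1) ≤ r * (K / r) := Nat.mul_le_mul_left r hlt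
    rw [Nat.mul_succ] at this
    omega
  · obtain ⟨rfl, rfl⟩ : i' = i ∧ α' = α := by
      have := i.2
      have := i'.2
      rw [Fin.ext_iff]
      omega
    rw [← h1, ← Nat.mod_eq_sub, Pi.sub_apply, coeff_sub, Pi.smul_apply, coeff_smul, smul_eq_mul,
      mul_sub, hnw]
    ring
  · have : K + 1 ≤ r * (2 * α' + i') := by
      rw [← h1] at hlt
      have hr : 0 < r := by
        rcases Nat.eq_zero_or_pos r with rfl | hr
        · exact absurd (Subsingleton.elim (α := ZMod 1) _ _) (by simpa using h2)
        · exact hr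
      rwa [Nat.div_lt_iff_lt_mul hr, mul_comm] at hlt
    rw [Nat.sub_eq_zero_of_le this] at hmem
    rw [Nat.sub_eq_zero_of_le (by omega)]
    exact hmem

end HasKey

end Keys

/-! ### Families of rows that account for all keys of a module. -/

section KeyedFamilies

variable {p r : ℕ}

/-- The rows of `V` lie in `M`, have keys `K i` that are pairwise incongruent modulo `2 * r`, and
account for all the keys that occur in `M`. -/
structure IsKeyed (M : Submodule (ZMod (p ^ r))[X] (Fin 2 → (ZMod (p ^ r))[X]))
    (V : Fin (2 * r) → Fin 2 → (ZMod (p ^ r))[X]) (K : Fin (2 * r) → ℕ) : Prop where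
  mem : ∀ i, V i ∈ M
  hasKey : ∀ i, HasKey (V i) (K i)
  inj : ∀ i j, K i ≡ K j [MOD 2 * r] → i = j
  exists_key : ∀ v ∈ M, ∀ n, HasKey v n → ∃ i t, n = K i + 2 * r * t

/-- `p ^ j` is the exact power of `p` that divides `a`. -/
def ExactPow (p j : ℕ) {r : ℕ} (a : ZMod (p ^ r)) : Prop :=
  (p : ZMod (p ^ r)) ^ j ∣ a ∧ ¬ (p : ZMod (p ^ r)) ^ (j + 1) ∣ a

namespace ExactPow

theorem unit_mul {j : ℕ} {a u : ZMod (p ^ r)} (hu : IsUnit u) :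
    ExactPow p j (u * a) ↔ ExactPow p j a := by
  simp only [ExactPow, hu.dvd_mul_left]

theorem add_of_dvd {j : ℕ} {a b : ZMod (p ^ r)} (ha : ExactPow p j a)
    (hb : (p : ZMod (p ^ r)) ^ (j + 1) ∣ b) : ExactPow p j (a + b) :=
  ⟨dvd_add ha.1 ((pow_dvd_pow _ (Nat.le_succ j)).trans hb),
    fun h => ha.2 ((dvd_add_left hb).1 h)⟩

theorem unique {i j : ℕ} {a : ZMod (p ^ r)} (hi : ExactPow p i a) (hj : ExactPow p j a) :
    i = j := by
  rcases lt_trichotomy i j with h | h | h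
  · exact absurd ((pow_dvd_pow _ h).trans hj.1) hi.2
  · exact h
  · exact absurd ((pow_dvd_pow _ h).trans hi.1) hj.2

variable [hp : Fact p.Prime]

theorem unit_mul_pow {j : ℕ} (hj : j < r) {u : ZMod (p ^ r)} (hu : IsUnit u) :
    ExactPow p j (u * (p : ZMod (p ^ r)) ^ j) :=
  ⟨dvd_mul_left _ _, ZMod.not_prime_pow_dvd hj hu⟩

theorem pow {j : ℕ} (hj : j < r) : ExactPow p j ((p : ZMod (p ^ r)) ^ j) := by
  simpa using unit_mul_pow hj (isUnit_one (M := ZMod (p ^ r)))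

theorem zero_iff (hr : 0 < r) {a : ZMod (p ^ r)} : ExactPow p 0 a ↔ IsUnit a := by
  rw [ExactPow, pow_zero, zero_add, pow_one]
  refine ⟨fun h => (ZMod.isUnit_or_prime_dvd a).resolve_right h.2, fun h => ⟨one_dvd _, ?_⟩⟩
  simpa using ZMod.not_prime_pow_dvd hr h

end ExactPow

namespace IsKeyed

variable {M : Submodule (ZMod (p ^ r))[X] (Fin 2 → (ZMod (p ^ r))[X])}
  {V : Fin (2 * r) → Fin 2 → (ZMod (p ^ r))[X]} {K : Fin (2 * r) → ℕ}

theorem pos (i : Fin (2 * r)) : 0 < r := by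
  have := i.2
  omega

/-- A functional that vanishes on `X • M` sees only the constant coefficients. -/
theorem map_smul_eq {φ : (Fin 2 → (ZMod (p ^ r))[X]) →ₗ[ZMod (p ^ r)] ZMod (p ^ r)}
    (hφ : ∀ v ∈ M, φ ((X : (ZMod (p ^ r))[X]) • v) = 0) {v : Fin 2 → (ZMod (p ^ r))[X]}
    (hv : v ∈ M) (c : (ZMod (p ^ r))[X]) : φ (c • v) = c.coeff 0 * φ v := by
  have hc : c • v = (X : (ZMod (p ^ r))[X]) • (c.divX • v) + c.coeff 0 • v := by
    conv_lhs => rw [← divX_mul_X_add c, add_smul, mul_comm, ← smul_smul]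
    congr 1
    ext j
    simp
  rw [hc, map_add, hφ _ (M.smul_mem _ hv), zero_add, map_smul, smul_eq_mul]

theorem const_smul_mem (M : Submodule (ZMod (p ^ r))[X] (Fin 2 → (ZMod (p ^ r))[X]))
    {v : Fin 2 → (ZMod (p ^ r))[X]} (hv : v ∈ M) (a : ZMod (p ^ r)) : a • v ∈ M := by
  have : a • v = C a • v := by
    ext j
    simp
  rw [this]
  exact M.smul_mem _ hv

variable [hp : Fact p.Prime]

/-- Division algorithm on the key: the key of `v` is that of some `X ^ t • V i`, and subtracting a
digit multiple of it lowers the key. -/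
theorem exists_expansion (h : IsKeyed M V K) (n : ℕ) :
    ∀ v ∈ M, v ∈ below p r n → ∃ c : Fin (2 * r) → (ZMod (p ^ r))[X],
      (∀ i m, (c i).coeff m ∈ digits p r) ∧
      (∀ i, c i ≠ 0 → K i + 2 * r * (c i).natDegree < n) ∧ v = ∑ i, c i • V i := by
  classical
  induction n with
  | zero =>
    intro v _ hv
    refine ⟨0, fun i m => ?_, fun i hi => absurd rfl hi, ?_⟩
    · simpa using zero_mem_digits
    · simp [mem_below_zero.1 hv]
  | succ n ih =>
    intro v hvM hv
    by_cases hvn : v ∈ below p r n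
    · obtain ⟨c, h1, h2, h3⟩ := ih v hvM hvn
      exact ⟨c, h1, fun i hi => (h2 i hi).trans (Nat.lt_succ_self n), h3⟩
    · obtain ⟨i, t, rfl⟩ := h.exists_key v hvM n ⟨hv, hvn⟩
      obtain ⟨a, ha, hw⟩ := ((h.hasKey i).X_pow_smul t).exists_digit hv
      have hsm : a • (X ^ t : (ZMod (p ^ r))[X]) • V i = (C a * X ^ t) • V i := by
        rw [← smul_smul]
        ext j
        simp
      rw [hsm] at hw
      obtain ⟨c, h1, h2, h3⟩ := ih _ (M.sub_mem hvM (M.smul_mem _ (h.mem i))) hw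
      have hr := pos i
      -- The terms already found have smaller key, so `c i` has no coefficient in degree `t` or
      -- above. The new digit fills an empty place and no carry arises.
      have hct : ∀ m, t ≤ m → (c i).coeff m = 0 := by
        intro m hm
        by_cases hc : c i = 0
        · rw [hc, coeff_zero]
        · refine coeff_eq_zero_of_natDegree_lt (lt_of_lt_of_le ?_ hm)
          have := h2 i hc
          exact Nat.lt_of_mul_lt_mul_left (a := 2 * r) (by omega)
      refine ⟨c + Pi.single i (C a * X ^ t), fun l m => ?_, fun l hl => ?_, ?_⟩
      · by_cases hli : l = i
        · subst hli
          rw [Pi.add_apply, Pi.single_eq_same, coeff_add, coeff_C_mul, coeff_X_pow]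
          split_ifs with hmt
          · rw [hct m hmt.ge, zero_add, mul_one]
            exact ha
          · rw [mul_zero, add_zero]
            exact h1 l m
        · rw [Pi.add_apply, Pi.single_eq_of_ne hli, add_zero]
          exact h1 l m
      · by_cases hli : l = i
        · subst hli
          have : (c l + C a * X ^ t).natDegree ≤ t := by
            refine natDegree_add_le_of_degree_le ?_ (natDegree_C_mul_X_pow_le a t)
            exact natDegree_le_iff_coeff_eq_zero.2 fun m hm => hct m hm.le
          rw [Pi.add_apply, Pi.single_eq_same]
          have := Nat.mul_le_mul_left (2 * r) this
          omega
        · rw [Pi.add_apply, Pi.single_eq_of_ne hli, add_zero] at hl ⊢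
          exact (h2 l hl).trans (Nat.lt_succ_self _)
      · rw [← sub_add_cancel v ((C a * X ^ t) • V i), h3]
        simp only [Pi.add_apply, add_smul, Finset.sum_add_distrib]
        congr 1
        rw [Finset.sum_eq_single i]
        · rw [Pi.single_eq_same]
        · intro l _ hl
          rw [Pi.single_eq_of_ne hl, zero_smul]
        · simp

variable {φ : (Fin 2 → (ZMod (p ^ r))[X]) →ₗ[ZMod (p ^ r)] ZMod (p ^ r)}

/-- In the expansion of `v` only rows of key below `n` occur, and `φ` sees only their constant
coefficients; so `φ v` is a combination of the values of `φ` on those rows. -/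
theorem exists_not_dvd (h : IsKeyed M V K)
    (hφ : ∀ v ∈ M, φ ((X : (ZMod (p ^ r))[X]) • v) = 0) {n : ℕ} {v : Fin 2 → (ZMod (p ^ r))[X]}
    (hvM : v ∈ M) (hv : v ∈ below p r n) {a : ZMod (p ^ r)} (ha : ¬ a ∣ φ v) :
    ∃ i, K i < n ∧ ¬ a ∣ φ (V i) := by
  by_contra! hcon
  obtain ⟨c, -, h2, rfl⟩ := h.exists_expansion n v hvM hv
  refine ha ?_
  rw [map_sum]
  refine Finset.dvd_sum fun i _ => ?_
  rw [map_smul_eq hφ (h.mem i)]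
  by_cases hc : c i = 0
  · rw [hc, coeff_zero, zero_mul]
    exact dvd_zero _
  · exact dvd_mul_of_dvd_right (hcon i (lt_of_le_of_lt (Nat.le_add_right _ _) (h2 i hc))) _

/-- The values of a functional on the rows of a keyed family pass through all powers of `p`, in
the order of the keys. -/
theorem exists_exactPow (h : IsKeyed M V K)
    (hφ : ∀ v ∈ M, φ ((X : (ZMod (p ^ r))[X]) • v) = 0) {j : ℕ} (hj : j < r) (n : ℕ) :
    ∀ l, K l = n → ¬ (p : ZMod (p ^ r)) ^ (j + 1) ∣ φ (V l) →
      ∃ l', ExactPow p j (φ (V l')) ∧ K l' ≤ n := by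
  induction n using Nat.strong_induction_on with
  | _ n ih =>
    intro l hl hnd
    by_cases hd : (p : ZMod (p ^ r)) ^ j ∣ φ (V l)
    · exact ⟨l, ⟨hd, hnd⟩, hl.le⟩
    · have hb := mem_below_smul (t := 1) (h.hasKey l).1
      obtain ⟨l', h1, h2⟩ := h.exists_not_dvd (a := (p : ZMod (p ^ r)) ^ (j + 1)) hφ
        (const_smul_mem M (h.mem l) _) hb (by
          rw [map_smul, smul_eq_mul, add_comm j 1]
          exact fun h' => hd (ZMod.prime_pow_mul_dvd (by omega) h'))
      obtain ⟨l'', h3, h4⟩ := ih (K l') (hl ▸ h1) l' rfl h2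
      exact ⟨l'', h3, by omega⟩

/-- Among the rows on which the functional takes a value of exact exponent `j`, the one with the
least key has the strictly least leading monomial. -/
theorem exists_least (h : IsKeyed M V K)
    (hφ : ∀ v ∈ M, φ ((X : (ZMod (p ^ r))[X]) • v) = 0) {j : ℕ} (hj : j < r)
    (hne : ∃ l, ExactPow p j (φ (V l))) :
    ∃ a, ExactPow p j (φ (V a)) ∧
      (∀ l, ¬ (p : ZMod (p ^ r)) ^ (j + 1) ∣ φ (V l) → K a ≤ K l) ∧
      ∀ b, ExactPow p j (φ (V b)) → b ≠ a → K a / r < K b / r := by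
  classical
  obtain ⟨a, ha, hmin⟩ := Finset.exists_min_image
    (Finset.univ.filter fun l => ExactPow p j (φ (V l))) K (by simpa [Finset.Nonempty] using hne)
  simp only [Finset.mem_filter, Finset.mem_univ, true_and] at ha hmin
  have hle : ∀ l, ¬ (p : ZMod (p ^ r)) ^ (j + 1) ∣ φ (V l) → K a ≤ K l := by
    intro l hl
    obtain ⟨l', h1, h2⟩ := h.exists_exactPow hφ hj (K l) l rfl hl
    exact (hmin l' h1).trans h2
  refine ⟨a, ha, hle, fun b hb hba => ?_⟩
  have hab : K a < K b := lt_of_le_of_ne (hmin b hb) fun he => hba (h.inj _ _ (by rw [he]))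
  refine lt_of_le_of_ne (Nat.div_le_div_right hab.le) fun heq => ?_
  obtain ⟨t, ht⟩ := Nat.exists_eq_add_of_lt hab
  -- If `V b` shared its leading monomial with `V a`, then `p ^ (t + 1) • V b` would have the key of
  -- `V a`. Cancelling the top layer of `V a` by it lowers the key and keeps the exact exponent `j`,
  -- against the minimality of `a`.
  have hkey : HasKey ((p : ZMod (p ^ r)) ^ (t + 1) • V b) (K a) := by
    have hkb := h.hasKey b
    rw [ht, add_assoc] at hkb
    exact hkb.prime_pow_smul (by rw [← add_assoc, ← ht, heq])
  obtain ⟨d, -, hd⟩ := hkey.exists_digit (h.hasKey a).1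
  obtain ⟨l, h1, h2⟩ := h.exists_not_dvd (a := (p : ZMod (p ^ r)) ^ (j + 1)) hφ
    (M.sub_mem (h.mem a) (const_smul_mem M (const_smul_mem M (h.mem b) _) d)) hd (by
      rw [map_sub, sub_eq_add_neg]
      refine (ha.add_of_dvd ?_).2
      rw [dvd_neg, map_smul, map_smul, smul_eq_mul, smul_eq_mul]
      refine dvd_mul_of_dvd_right ?_ _
      rw [add_comm j 1, pow_add]
      exact mul_dvd_mul (pow_dvd_pow _ (Nat.le_add_left 1 t)) hb.1)
  exact absurd (hle l h2) (not_le.2 h1)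

end IsKeyed

end KeyedFamilies

/-! ### Error trajectories as power series. -/

section Residues

variable {p r : ℕ}

/-- The generating series of `S 1, S 2, …`. -/
def seqSeries (S : ℕ → ZMod (p ^ r)) : PowerSeries (ZMod (p ^ r)) :=
  PowerSeries.mk fun n => if n = 0 then 0 else S n

/-- The power series whose coefficients are the values of the error trajectory of `v`. -/
def residue (S : ℕ → ZMod (p ^ r)) (v : Fin 2 → (ZMod (p ^ r))[X]) : PowerSeries (ZMod (p ^ r)) :=
  (v 0 : PowerSeries (ZMod (p ^ r))) + (v 1 : PowerSeries (ZMod (p ^ r))) * seqSeries S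

variable (S : ℕ → ZMod (p ^ r))

theorem residue_add (v w : Fin 2 → (ZMod (p ^ r))[X]) :
    residue S (v + w) = residue S v + residue S w := by
  simp only [residue, Pi.add_apply, Polynomial.coe_add]
  ring

theorem residue_smul (c : (ZMod (p ^ r))[X]) (v : Fin 2 → (ZMod (p ^ r))[X]) :
    residue S (c • v) = (c : PowerSeries (ZMod (p ^ r))) * residue S v := by
  simp only [residue, Pi.smul_apply, smul_eq_mul, Polynomial.coe_mul]
  ring

theorem C_smul_row (a : ZMod (p ^ r)) (v : Fin 2 → (ZMod (p ^ r))[X]) : C a • v = a • v := by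
  ext j
  simp

/-- The row vectors whose error trajectory on `S 1, …, S k` vanishes. -/
def solutions (k : ℕ) : Submodule (ZMod (p ^ r))[X] (Fin 2 → (ZMod (p ^ r))[X]) where
  carrier := {v | PowerSeries.X ^ (k + 1) ∣ residue S v}
  add_mem' hv hw := by
    rw [Set.mem_ofPred_eq, residue_add]
    exact dvd_add hv hw
  zero_mem' := by simp [residue]
  smul_mem' c v hv := by
    rw [Set.mem_ofPred_eq, residue_smul]
    exact dvd_mul_of_dvd_right hv _

/-- The last value of the error trajectory of `v` on `S 1, …, S k`. -/
def lastError (k : ℕ) : (Fin 2 → (ZMod (p ^ r))[X]) →ₗ[ZMod (p ^ r)] ZMod (p ^ r) where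
  toFun v := PowerSeries.coeff k (residue S v)
  map_add' v w := by rw [residue_add, map_add]
  map_smul' a v := by
    rw [← C_smul_row, residue_smul, Polynomial.coe_C, PowerSeries.coeff_C_mul]
    rfl

/-- The constant coefficient of the second entry. -/
def constCoeff₂ : (Fin 2 → (ZMod (p ^ r))[X]) →ₗ[ZMod (p ^ r)] ZMod (p ^ r) where
  toFun v := (v 1).coeff 0
  map_add' v w := by simp
  map_smul' a v := by simp

variable {S}

theorem mem_solutions {k : ℕ} {v : Fin 2 → (ZMod (p ^ r))[X]} :
    v ∈ solutions S k ↔ ∀ m ≤ k, lastError S m v = 0 := by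
  change PowerSeries.X ^ (k + 1) ∣ residue S v ↔ _
  rw [PowerSeries.X_pow_dvd_iff]
  simp only [Nat.lt_succ_iff]
  rfl

theorem mem_solutions_succ {k : ℕ} {v : Fin 2 → (ZMod (p ^ r))[X]} :
    v ∈ solutions S (k + 1) ↔ v ∈ solutions S k ∧ lastError S (k + 1) v = 0 := by
  simp only [mem_solutions]
  constructor
  · exact fun h => ⟨fun m hm => h m (by omega), h _ le_rfl⟩
  · rintro ⟨h1, h2⟩ m hm
    rcases Nat.le_succ_iff.1 hm with h | rfl
    exacts [h1 m h, h2]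

theorem lastError_X_smul (k : ℕ) (v : Fin 2 → (ZMod (p ^ r))[X]) :
    lastError S (k + 1) ((X : (ZMod (p ^ r))[X]) • v) = lastError S k v := by
  change PowerSeries.coeff (k + 1) (residue S _) = PowerSeries.coeff k (residue S v)
  rw [residue_smul, Polynomial.coe_X, PowerSeries.coeff_succ_X_mul]

/-- This is the hypothesis needed to apply the results on keyed families to the error at time `k +
1`. -/
theorem lastError_succ_X_smul {k : ℕ} {v : Fin 2 → (ZMod (p ^ r))[X]} (hv : v ∈ solutions S k) :
    lastError S (k + 1) ((X : (ZMod (p ^ r))[X]) • v) = 0 := by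
  rw [lastError_X_smul]
  exact mem_solutions.1 hv k le_rfl

theorem constCoeff₂_X_smul (v : Fin 2 → (ZMod (p ^ r))[X]) :
    constCoeff₂ ((X : (ZMod (p ^ r))[X]) • v) = 0 := by
  simp [constCoeff₂]

/-- The term `α = k` is absent because the generating series starts at `S 1`. -/
theorem lastError_eq_sum (k : ℕ) (v : Fin 2 → (ZMod (p ^ r))[X]) :
    lastError S k v = (v 0).coeff k + ∑ α ∈ Finset.range k, (v 1).coeff α * S (k - α) := by
  change PowerSeries.coeff k (residue S v) = _
  rw [residue, map_add, Polynomial.coeff_coe, PowerSeries.coeff_mul,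
    Finset.Nat.sum_antidiagonal_eq_sum_range_succ_mk, Finset.sum_range_succ]
  congr 1
  simp only [Polynomial.coeff_coe, seqSeries, PowerSeries.coeff_mk, Nat.sub_self, if_true, mul_zero,
    add_zero]
  refine Finset.sum_congr rfl fun α hα => ?_
  rw [if_neg]
  have := Finset.mem_range.1 hα
  omega

theorem shift_iterate {R : Type*} [CommRing R] (n : ℕ) (b : ℕ → Fin 2 → R) (m : ℕ) :
    shift^[n] b m = b (m + n) := by
  induction n generalizing b with
  | zero => rfl
  | succ n ih => rw [Function.iterate_succ_apply, ih, shift, add_assoc]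

/-- After `N - k` shifts, the value `(1, 0)` lies `k` units before the end and picks out the
coefficient `k` of the first entry; the later values give the convolution with `S`. -/
theorem discrepancy_eq {N k : ℕ} (hk : k ≤ N)
    (V : Matrix (Fin (2 * r)) (Fin 2) (ZMod (p ^ r))[X]) (i : Fin (2 * r)) :
    discrepancy S N k V i = lastError S k (V i) := by
  have hsum : ∀ (f : (ZMod (p ^ r))[X]) (g : ℕ → ZMod (p ^ r)),
      f.sum (fun α a => a * g α) = ∑ α ∈ Finset.range (f.natDegree + k + 1), f.coeff α * g α :=
    fun f g => Polynomial.sum_over_range' f (f := fun α a => a * g α) (fun n => zero_mul _) _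
      (by omega)
  rw [discrepancy, applyShift, lastError_eq_sum, Fin.sum_univ_two]
  simp only [shift_iterate, zero_add]
  congr 1
  · rw [hsum, Finset.sum_eq_single k]
    · rw [dataTraj, if_neg (by omega), if_pos (by omega)]
      simp
    · intro α _ hα
      rw [dataTraj]
      split_ifs with h1 h2
      · simp
      · omega
      · simp
    · intro h
      exact absurd (Finset.mem_range.2 (by omega)) h
  · rw [hsum]
    symm
    rw [← Finset.sum_subset (Finset.range_subset_range.2
      (show k ≤ (V i 1).natDegree + k + 1 by omega))]
    · refine Finset.sum_congr rfl fun α hα => ?_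
      have := Finset.mem_range.1 hα
      rw [dataTraj, if_pos (by omega), show N - (α + (N - k)) = k - α by omega]
      simp
    · intro α _ hα
      rw [Finset.mem_range] at hα
      rw [dataTraj, if_neg (by omega)]
      split_ifs <;> simp

end Residues

/-! ### The rows of the updated matrix. -/

section UpdateRows

variable {p r : ℕ}

theorem single_mul_row {l m n : Type*} [Fintype m] [DecidableEq l] [DecidableEq m] {R : Type*}
    [CommRing R] (i i' : l) (j : m) (a : R) (V : Matrix m n R) :
    (Matrix.single i j a * V) i' = if i = i' then a • V j else 0 := by
  ext c
  split_ifs with h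
  · subst h
    simp
  · simp [Matrix.single_mul_apply_of_ne _ _ _ _ _ (Ne.symm h)]

variable {Δ : Fin (2 * r) → ZMod (p ^ r)} {θ : Fin (2 * r) → (ZMod (p ^ r))ˣ}
  {e : Fin (2 * r) → Fin r} {istar : Fin r → Fin (2 * r)}
  (V : Matrix (Fin (2 * r)) (Fin 2) (ZMod (p ^ r))[X])

theorem mem_classP {j : Fin r} {i : Fin (2 * r)} : i ∈ classP Δ e j ↔ Δ i ≠ 0 ∧ e i = j := by
  simp [classP]

theorem updateMatrix_mul_row (i : Fin (2 * r)) :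
    (updateMatrix Δ θ e istar * V) i = (if Δ i = 0 then V i else 0) +
      ∑ j : Fin r,
        ((if lowRow j = i then
            (((θ (istar j))⁻¹ : (ZMod (p ^ r))ˣ) : ZMod (p ^ r)) •
              (X : (ZMod (p ^ r))[X]) • V (istar j) else 0) +
          (if istar j = i then
            (θ (lowRow j) : ZMod (p ^ r)) • V (istar j) -
              (θ (istar j) : ZMod (p ^ r)) • V (lowRow j) else 0) +
          (if i ∈ classP Δ e j \ {lowRow j, istar j} then
            (θ (istar j) : ZMod (p ^ r)) • V i - (θ i : ZMod (p ^ r)) • V (istar j) else 0)) := by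
  have happ : ∀ {ι : Type} (s : Finset ι)
      (f : ι → Matrix (Fin (2 * r)) (Fin 2) (ZMod (p ^ r))[X]), (∑ x ∈ s, f x) i = ∑ x ∈ s, f x i :=
    fun s f => Finset.sum_apply _ _ _
  have hadd : ∀ A B : Matrix (Fin (2 * r)) (Fin 2) (ZMod (p ^ r))[X], (A + B) i = A i + B i :=
    fun _ _ => rfl
  simp only [updateMatrix, Matrix.add_mul, Matrix.sum_mul, hadd, happ, single_mul_row]
  congr 1
  · rw [Finset.sum_ite_eq']
    simp
  · refine Finset.sum_congr rfl fun j _ => ?_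
    congr 1
    · congr 1
      · rw [← smul_smul, C_smul_row]
      · rw [← C_neg, C_smul_row, C_smul_row]
        split_ifs
        · rw [neg_smul]
          abel
        · exact add_zero _
    · simp only [← C_neg, C_smul_row]
      rw [Finset.sum_add_distrib, Finset.sum_ite_eq', Finset.sum_ite_eq']
      split_ifs
      · rw [neg_smul]
        abel
      · exact add_zero _

variable (hlow : ∀ j, lowRow j ∈ classP Δ e j) (hstar : ∀ j, istar j ∈ classP Δ e j)

include hlow hstar

theorem updateMatrix_row_of_zero {i : Fin (2 * r)} (hi : Δ i = 0) :
    (updateMatrix Δ θ e istar * V) i = V i := by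
  rw [updateMatrix_mul_row, if_pos hi, Finset.sum_eq_zero, add_zero]
  intro j _
  have h1 : lowRow j ≠ i := fun h => (mem_classP.1 (hlow j)).1 (h ▸ hi)
  have h2 : istar j ≠ i := fun h => (mem_classP.1 (hstar j)).1 (h ▸ hi)
  have h3 : i ∉ classP Δ e j \ {lowRow j, istar j} := fun h =>
    (mem_classP.1 (Finset.mem_sdiff.1 h).1).1 hi
  rw [if_neg h1, if_neg h2, if_neg h3, add_zero, add_zero]

theorem updateMatrix_row_of_mem {i : Fin (2 * r)} {j : Fin r} (hi : i ∈ classP Δ e j) :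
    (updateMatrix Δ θ e istar * V) i =
      (if lowRow j = i then
        (((θ (istar j))⁻¹ : (ZMod (p ^ r))ˣ) : ZMod (p ^ r)) •
          (X : (ZMod (p ^ r))[X]) • V (istar j) else 0) +
      (if istar j = i then
        (θ (lowRow j) : ZMod (p ^ r)) • V (istar j) -
          (θ (istar j) : ZMod (p ^ r)) • V (lowRow j) else 0) +
      (if i ∈ classP Δ e j \ {lowRow j, istar j} then
        (θ (istar j) : ZMod (p ^ r)) • V i - (θ i : ZMod (p ^ r)) • V (istar j) else 0) := by
  rw [mem_classP] at hi
  rw [updateMatrix_mul_row, if_neg hi.1, zero_add, Finset.sum_eq_single j]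
  · intro j' _ hj'
    have h1 : lowRow j' ≠ i := fun h => hj' ((mem_classP.1 (hlow j')).2.symm.trans (h ▸ hi.2))
    have h2 : istar j' ≠ i := fun h => hj' ((mem_classP.1 (hstar j')).2.symm.trans (h ▸ hi.2))
    have h3 : i ∉ classP Δ e j' \ {lowRow j', istar j'} := fun h =>
      hj' ((mem_classP.1 (Finset.mem_sdiff.1 h).1).2.symm.trans hi.2)
    rw [if_neg h1, if_neg h2, if_neg h3, add_zero, add_zero]
  · simp

theorem updateMatrix_row_low (j : Fin r) :
    (updateMatrix Δ θ e istar * V) (lowRow j) =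
      (((θ (istar j))⁻¹ : (ZMod (p ^ r))ˣ) : ZMod (p ^ r)) •
        (X : (ZMod (p ^ r))[X]) • V (istar j) := by
  rw [updateMatrix_row_of_mem V hlow hstar (hlow j), if_pos rfl,
    if_neg (show lowRow j ∉ classP Δ e j \ {lowRow j, istar j} by simp), add_zero]
  split_ifs with h
  -- When row `j` is its own pivot, the two entries meant for the pivot's row cancel.
  · rw [h, sub_self, add_zero]
  · rw [add_zero]

theorem updateMatrix_row_star {j : Fin r} (h : istar j ≠ lowRow j) :
    (updateMatrix Δ θ e istar * V) (istar j) =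
      (θ (lowRow j) : ZMod (p ^ r)) • V (istar j) -
        (θ (istar j) : ZMod (p ^ r)) • V (lowRow j) := by
  rw [updateMatrix_row_of_mem V hlow hstar (hstar j), if_neg h.symm, if_pos rfl,
    if_neg (show istar j ∉ classP Δ e j \ {lowRow j, istar j} by simp), add_zero, zero_add]

theorem updateMatrix_row_other {i : Fin (2 * r)} {j : Fin r} (hi : i ∈ classP Δ e j)
    (h1 : i ≠ lowRow j) (h2 : i ≠ istar j) :
    (updateMatrix Δ θ e istar * V) i =
      (θ (istar j) : ZMod (p ^ r)) • V i - (θ i : ZMod (p ^ r)) • V (istar j) := by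
  rw [updateMatrix_row_of_mem V hlow hstar hi, if_neg h1.symm, if_neg h2.symm,
    if_pos (Finset.mem_sdiff.2 ⟨hi, by simp [h1, h2]⟩), add_zero, zero_add]

end UpdateRows

/-! ### The loop invariant and the initial matrix. -/

section Invariant

variable {p r : ℕ}

/-- The row index `r + j`. -/
def highRow (j : Fin r) : Fin (2 * r) := ⟨r + j.1, by have := j.2; omega⟩

theorem exists_lowRow_or_highRow (i : Fin (2 * r)) :
    (∃ j, i = lowRow j) ∨ ∃ j, i = highRow j := by
  have := i.2
  rcases lt_or_ge i.1 r with h | h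
  · exact Or.inl ⟨⟨i, h⟩, rfl⟩
  · refine Or.inr ⟨⟨i - r, by omega⟩, Fin.ext ?_⟩
    simp only [highRow]
    omega

theorem lowRow_ne_highRow (i j : Fin r) : lowRow i ≠ highRow j := by
  have := i.2
  simp only [lowRow, highRow, ne_eq, Fin.ext_iff]
  omega

theorem initMatrix_low (j : Fin r) :
    initMatrix p r (lowRow j) = ![C ((p : ZMod (p ^ r)) ^ (j : ℕ)) * X, 0] := by
  rw [initMatrix, if_pos (by exact j.2)]
  rfl

theorem initMatrix_high (j : Fin r) :
    initMatrix p r (highRow j) = ![0, C ((p : ZMod (p ^ r)) ^ (j : ℕ))] := by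
  rw [initMatrix, if_neg (by simp [highRow])]
  simp [highRow]

/-- The properties of the matrices `R^k` that the algorithm maintains. -/
structure IsLoopInvariant (S : ℕ → ZMod (p ^ r)) (k : ℕ)
    (V : Matrix (Fin (2 * r)) (Fin 2) (ZMod (p ^ r))[X]) (K : Fin (2 * r) → ℕ) : Prop where
  keyed : IsKeyed (solutions S k) V K
  const_low : ∀ j, constCoeff₂ (V (lowRow j)) = 0
  error_low : ∀ j : Fin r, lastError S (k + 1) (V (lowRow j)) = (p : ZMod (p ^ r)) ^ (j : ℕ)
  const_high : ∀ j : Fin r, ExactPow p j (constCoeff₂ (V (highRow j)))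

variable [hp : Fact p.Prime] {S : ℕ → ZMod (p ^ r)}

/-- The scalar `p ^ j` has order `r - j`, whence the offset `r - 1 - j`. -/
theorem hasKey_of_coeff {v : Fin 2 → (ZMod (p ^ r))[X]} {j : ℕ} (hj : j < r) (i : Fin 2) (α : ℕ)
    (hv : ∀ i' α', (v i').coeff α' = if i' = i ∧ α' = α then (p : ZMod (p ^ r)) ^ j else 0) :
    HasKey v (r * (2 * α + i) + (r - 1 - j)) := by
  constructor
  · intro i' α'
    rw [hv]
    split_ifs with h
    · rw [h.1, h.2, ← pow_add, ZMod.prime_pow_eq_zero_of_le]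
      omega
    · exact mul_zero _
  · intro h
    have h1 := h i α
    rw [hv, if_pos ⟨rfl, rfl⟩, ← pow_add] at h1
    have h2 := (ExactPow.pow (p := p) (r := r) (j := r - 1) (by omega)).2
    rw [show r * (2 * α + i) + (r - 1 - j) - r * (2 * α + (i : ℕ)) + j = r - 1 by omega] at h1
    rw [h1] at h2
    exact h2 (dvd_zero _)

theorem isLoopInvariant_init (S : ℕ → ZMod (p ^ r)) : IsLoopInvariant S 0 (initMatrix p r)
    (fun i => if (i : ℕ) < r then 2 * r + (r - 1 - i) else r + (r - 1 - (i - r))) := by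
  refine ⟨⟨fun i => ?_, fun i => ?_, fun i j hij => ?_, fun v hv n hn => ?_⟩, fun j => ?_,
    fun j => ?_, fun j => ?_⟩
  · rw [mem_solutions]
    intro m hm
    obtain rfl : m = 0 := by omega
    rw [lastError_eq_sum]
    obtain ⟨j, rfl⟩ | ⟨j, rfl⟩ := exists_lowRow_or_highRow i
    · simp [initMatrix_low]
    · simp [initMatrix_high]
  · obtain ⟨j, rfl⟩ | ⟨j, rfl⟩ := exists_lowRow_or_highRow i
    · have := hasKey_of_coeff (p := p) (v := initMatrix p r (lowRow j)) j.2 0 1 (by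
        intro i' α'
        rw [initMatrix_low]
        fin_cases i'
        · simp only [Fin.zero_eta, Matrix.cons_val_zero, coeff_C_mul, coeff_X, true_and,
            eq_comm (a := α')]
          split_ifs <;> simp
        · simp)
      convert this using 1
      have := j.2
      simp only [lowRow, j.2, if_true, Fin.val_zero]
      ring_nf
    · have := hasKey_of_coeff (p := p) (v := initMatrix p r (highRow j)) j.2 1 0 (by
        intro i' α'
        rw [initMatrix_high]
        fin_cases i'
        · simp
        · simp [coeff_C, -map_pow])
      convert this using 1
      simp [highRow]
  · have hi := i.2
    have hj := j.2
    have h2 : ∀ i : ℕ, (2 * r + (r - 1 - i)) % (2 * r) = (r - 1 - i) % (2 * r) := by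
      intro i
      rw [Nat.add_mod_left]
    simp only [Nat.ModEq] at hij
    rw [Fin.ext_iff]
    split_ifs at hij with h1 h3 h3
    · rw [h2, h2, Nat.mod_eq_of_lt (by omega), Nat.mod_eq_of_lt (by omega)] at hij
      omega
    · rw [h2, Nat.mod_eq_of_lt (by omega), Nat.mod_eq_of_lt (by omega)] at hij
      omega
    · rw [h2, Nat.mod_eq_of_lt (by omega), Nat.mod_eq_of_lt (by omega)] at hij
      omega
    · rw [Nat.mod_eq_of_lt (by omega), Nat.mod_eq_of_lt (by omega)] at hij
      omega
  · obtain ⟨i, α, h1, h2⟩ := hn.lead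
    have hr : 0 < r := by
      rcases Nat.eq_zero_or_pos r with rfl | hr
      · exact absurd (Subsingleton.elim (α := ZMod 1) _ _) (by simpa using h2)
      · exact hr
    -- A key below `r` would mean leading monomial `e_1`, whose coefficient is the error at time `0`
    -- and vanishes.
    have hnr : r ≤ n := by
      by_contra hlt
      rw [Nat.div_eq_of_lt (by omega)] at h1
      have h3 := mem_solutions.1 hv 0 le_rfl
      rw [lastError_eq_sum, Finset.range_zero, Finset.sum_empty, add_zero] at h3
      obtain rfl : i = 0 := Fin.ext (by simp; omega)
      obtain rfl : α = 0 := by omega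
      exact h2 (by rw [h3, mul_zero])
    have hmod := Nat.div_add_mod n (2 * r)
    have hlt := Nat.mod_lt n (show 0 < 2 * r by omega)
    -- Residues below `r` belong to position 1. As keys below `r` are excluded, these are at least
    -- `2 * r`, which matches the factor `x` in the low rows.
    rcases lt_or_ge (n % (2 * r)) r with h | h
    · refine ⟨lowRow ⟨r - 1 - n % (2 * r), by omega⟩, n / (2 * r) - 1, ?_⟩
      have hq : n / (2 * r) ≠ 0 := by
        intro h0
        rw [h0] at hmod
        omega
      obtain ⟨q, hq⟩ := Nat.exists_eq_succ_of_ne_zero hq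
      rw [hq, Nat.succ_eq_add_one, mul_add] at hmod
      rw [if_pos (by simp only [lowRow]; omega), hq, Nat.succ_sub_one]
      simp only [lowRow]
      omega
    · refine ⟨highRow ⟨2 * r - 1 - n % (2 * r), by omega⟩, n / (2 * r), ?_⟩
      rw [if_neg (by simp only [highRow]; omega)]
      simp only [highRow]
      omega
  · simp [constCoeff₂, initMatrix_low]
  · rw [lastError_eq_sum]
    simp [initMatrix_low, -map_pow]
  · have : constCoeff₂ (initMatrix p r (highRow j)) = (p : ZMod (p ^ r)) ^ (j : ℕ) := by
      simp only [constCoeff₂, LinearMap.coe_mk, AddHom.coe_mk, initMatrix_high, Matrix.cons_val_one,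
        Matrix.cons_val_fin_one]
      exact coeff_C_zero
    rw [this]
    exact ExactPow.pow j.2

end Invariant

/-! ### One step of the algorithm preserves the invariant. -/

section Step

variable {p r : ℕ} {S : ℕ → ZMod (p ^ r)} {k : ℕ}
  {V : Matrix (Fin (2 * r)) (Fin 2) (ZMod (p ^ r))[X]} {K : Fin (2 * r) → ℕ}
  {θ : Fin (2 * r) → (ZMod (p ^ r))ˣ} {e : Fin (2 * r) → Fin r} {istar : Fin r → Fin (2 * r)}

/-- The permutation that exchanges the row `j` with the row `i_j^⋆`, for all `j`. -/
def pivotSwap (Δ : Fin (2 * r) → ZMod (p ^ r)) (e : Fin (2 * r) → Fin r)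
    (istar : Fin r → Fin (2 * r)) (i : Fin (2 * r)) : Fin (2 * r) :=
  if Δ i = 0 then i else Equiv.swap (lowRow (e i)) (istar (e i)) i

theorem pivotSwap_of_mem {Δ : Fin (2 * r) → ZMod (p ^ r)} {j : Fin r} {i : Fin (2 * r)}
    (hi : i ∈ classP Δ e j) : pivotSwap Δ e istar i = Equiv.swap (lowRow j) (istar j) i := by
  rw [mem_classP] at hi
  rw [pivotSwap, if_neg hi.1, hi.2]

theorem pivotSwap_involutive {Δ : Fin (2 * r) → ZMod (p ^ r)}
    (hlow : ∀ j, lowRow j ∈ classP Δ e j) (hstar : ∀ j, istar j ∈ classP Δ e j) :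
    Function.Involutive (pivotSwap Δ e istar) := by
  intro i
  by_cases hi : Δ i = 0
  · rw [pivotSwap, pivotSwap, if_pos hi, if_pos hi]
  · obtain ⟨j, hmem⟩ : ∃ j, i ∈ classP Δ e j := ⟨e i, mem_classP.2 ⟨hi, rfl⟩⟩
    rw [pivotSwap_of_mem hmem, pivotSwap_of_mem (j := j), Equiv.swap_apply_self]
    rcases eq_or_ne i (lowRow j) with rfl | h
    · rw [Equiv.swap_apply_left]
      exact hstar _
    · rcases eq_or_ne i (istar j) with rfl | h'
      · rw [Equiv.swap_apply_right]
        exact hlow _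
      · rwa [Equiv.swap_apply_of_ne_of_ne h h']

theorem HasKey.smul_sub_smul {v w : Fin 2 → (ZMod (p ^ r))[X]} {m n : ℕ} (hv : HasKey v m)
    (hw : HasKey w n) (hlt : n < m) {a b : ZMod (p ^ r)} (ha : IsUnit a) :
    HasKey (a • v - b • w) m := by
  rw [sub_eq_add_neg]
  exact (hv.unit_smul ha).add_mem
    (Submodule.neg_mem _ (Submodule.smul_mem _ _ (below_mono hlt hw.1)))

variable [hp : Fact p.Prime]

/-- Hence the classes do not depend on the choice of the units `θ`. -/
theorem mem_classP_iff_exactPow {Δ : Fin (2 * r) → ZMod (p ^ r)}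
    (hΔ : ∀ i, Δ i ≠ 0 → Δ i = (θ i : ZMod (p ^ r)) * (p : ZMod (p ^ r)) ^ (e i).1)
    {i : Fin (2 * r)} {j : Fin r} : i ∈ classP Δ e j ↔ ExactPow p j (Δ i) := by
  rw [mem_classP]
  constructor
  · rintro ⟨h, rfl⟩
    rw [hΔ i h]
    exact ExactPow.unit_mul_pow (e i).2 (θ i).isUnit
  · intro h
    have h0 : Δ i ≠ 0 := fun h0 => h.2 (h0 ▸ dvd_zero _)
    refine ⟨h0, Fin.ext (ExactPow.unique (r := r) ?_ h)⟩
    rw [hΔ i h0]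
    exact ExactPow.unit_mul_pow (e i).2 (θ i).isUnit

namespace IsLoopInvariant

theorem low_mem (h : IsLoopInvariant S k V K)
    (hΔ : ∀ i, lastError S (k + 1) (V i) ≠ 0 → lastError S (k + 1) (V i) =
      (θ i : ZMod (p ^ r)) * (p : ZMod (p ^ r)) ^ (e i).1) (j : Fin r) :
    lowRow j ∈ classP (fun i => lastError S (k + 1) (V i)) e j := by
  rw [mem_classP_iff_exactPow hΔ]
  simp only [h.error_low]
  exact ExactPow.pow j.2

/-- By `IsKeyed.exists_exactPow` for `constCoeff₂`, exponents grow as keys shrink: from row `n` with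
`n ≤ m` one would reach a row of exact exponent `m` and no larger key. Low rows have value zero, so
it could only be `highRow m`. -/
theorem const_high_lt (h : IsLoopInvariant S k V K) {m n : Fin r}
    (hmn : K (highRow n) < K (highRow m)) : m < n := by
  by_contra hle
  have hnd : ¬ (p : ZMod (p ^ r)) ^ ((m : ℕ) + 1) ∣ constCoeff₂ (V (highRow n)) := fun hd =>
    (h.const_high n).2 ((pow_dvd_pow _ (Nat.succ_le_succ (not_lt.1 hle))).trans hd)
  obtain ⟨l, h1, h2⟩ := h.keyed.exists_exactPow (fun v _ => constCoeff₂_X_smul v) m.2 _ _ rfl hnd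
  obtain ⟨j, rfl⟩ | ⟨j, rfl⟩ := exists_lowRow_or_highRow l
  · rw [h.const_low] at h1
    exact h1.2 (dvd_zero _)
  · obtain rfl : j = m := Fin.ext ((h.const_high j).unique h1)
    omega

/-- The least leading monomial in a class is attained only once, so the rule for breaking ties plays
no role here. -/
theorem pivot_spec (h : IsLoopInvariant S k V K)
    (hΔ : ∀ i, lastError S (k + 1) (V i) ≠ 0 → lastError S (k + 1) (V i) =
      (θ i : ZMod (p ^ r)) * (p : ZMod (p ^ r)) ^ (e i).1) {j : Fin r}
    (hstar : istar j ∈ classP (fun i => lastError S (k + 1) (V i)) e j)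
    (hmin : ∀ i ∈ classP (fun i => lastError S (k + 1) (V i)) e j, lm (V (istar j)) ≤ lm (V i)) :
    (∀ l, ¬ (p : ZMod (p ^ r)) ^ ((j : ℕ) + 1) ∣ lastError S (k + 1) (V l) →
      K (istar j) ≤ K l) ∧
    ∀ i ∈ classP (fun i => lastError S (k + 1) (V i)) e j, i ≠ istar j → K (istar j) < K i := by
  have hr : 0 < r := by have := j.2; omega
  obtain ⟨a, ha, h1, h2⟩ := h.keyed.exists_least (fun v hv => lastError_succ_X_smul hv) j.2
    ⟨istar j, (mem_classP_iff_exactPow hΔ).1 hstar⟩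
  have hle := ((h.keyed.hasKey _).lm_le_lm_iff (h.keyed.hasKey _) hr).1
    (hmin a ((mem_classP_iff_exactPow hΔ).2 ha))
  have heq : istar j = a := by
    by_contra hne
    have := h2 _ ((mem_classP_iff_exactPow hΔ).1 hstar) hne
    omega
  rw [heq]
  refine ⟨h1, fun i hi hia => ?_⟩
  by_contra hlt
  have := h2 i ((mem_classP_iff_exactPow hΔ).1 hi) hia
  have := Nat.div_le_div_right (c := r) (not_lt.1 hlt)
  omega

/-- The new keys are the old ones with those of row `j` and its pivot exchanged, then raised by `2 *
r` on the low rows. Thus residues are permuted, and the only keys lost are those of the pivots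
themselves. -/
theorem step (h : IsLoopInvariant S k V K)
    (hΔ : ∀ i, lastError S (k + 1) (V i) ≠ 0 → lastError S (k + 1) (V i) =
      (θ i : ZMod (p ^ r)) * (p : ZMod (p ^ r)) ^ (e i).1)
    (hstar : ∀ j, istar j ∈ classP (fun i => lastError S (k + 1) (V i)) e j)
    (hmin : ∀ j, ∀ i ∈ classP (fun i => lastError S (k + 1) (V i)) e j,
      lm (V (istar j)) ≤ lm (V i)) :
    IsLoopInvariant S (k + 1)
      (updateMatrix (fun i => lastError S (k + 1) (V i)) θ e istar * V)
      (fun i => K (pivotSwap (fun i => lastError S (k + 1) (V i)) e istar i) +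
        2 * r * if (i : ℕ) < r then 1 else 0) := by
  have hlow := h.low_mem hΔ
  have hspec := fun j => h.pivot_spec hΔ (hstar j) (hmin j)
  set Δ : Fin (2 * r) → ZMod (p ^ r) := fun i => lastError S (k + 1) (V i)
  set V' := updateMatrix Δ θ e istar * V
  have hzero : ∀ i, Δ i = 0 → V' i = V i := fun i => updateMatrix_row_of_zero V hlow hstar
  have hlow' : ∀ j, V' (lowRow j) = _ := updateMatrix_row_low V hlow hstar
  have hstar' : ∀ j, istar j ≠ lowRow j → V' (istar j) = _ := fun j =>
    updateMatrix_row_star V hlow hstar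
  have hother : ∀ i j, i ∈ classP Δ e j → i ≠ lowRow j → i ≠ istar j → V' i = _ := fun i j =>
    updateMatrix_row_other V hlow hstar
  have hval : ∀ i j, i ∈ classP Δ e j →
      lastError S (k + 1) (V i) = (θ i : ZMod (p ^ r)) * (p : ZMod (p ^ r)) ^ (j : ℕ) := by
    intro i j hi
    rw [mem_classP] at hi
    rw [← hi.2]
    exact hΔ i hi.1
  have hmemM : ∀ i, V i ∈ solutions S k := h.keyed.mem
  have hcomb : ∀ i l j, i ∈ classP Δ e j → l ∈ classP Δ e j →
      (θ l : ZMod (p ^ r)) • V i - (θ i : ZMod (p ^ r)) • V l ∈ solutions S (k + 1) := by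
    intro i l j hi hl
    refine mem_solutions_succ.2 ⟨Submodule.sub_mem _ (IsKeyed.const_smul_mem _ (hmemM i) _)
      (IsKeyed.const_smul_mem _ (hmemM l) _), ?_⟩
    rw [map_sub, map_smul, map_smul, hval i j hi, hval l j hl, smul_eq_mul, smul_eq_mul]
    ring
  have hhigh : ∀ m j : Fin r, highRow m ≠ lowRow j := fun m j => (lowRow_ne_highRow j m).symm
  have hnlt : ∀ m : Fin r, ¬ ((highRow m : Fin (2 * r)) : ℕ) < r := fun m => by simp [highRow]
  have hlt : ∀ m : Fin r, ((lowRow m : Fin (2 * r)) : ℕ) < r := fun m => m.2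
  refine ⟨⟨fun i => ?_, fun i => ?_, fun i j hij => ?_, fun v hv n hn => ?_⟩, fun j => ?_,
    fun j => ?_, fun m => ?_⟩
  · obtain ⟨j, rfl⟩ | ⟨m, rfl⟩ := exists_lowRow_or_highRow i
    · rw [hlow']
      exact IsKeyed.const_smul_mem _ (mem_solutions_succ.2
        ⟨Submodule.smul_mem _ _ (hmemM _), lastError_succ_X_smul (hmemM _)⟩) _
    · by_cases hi : Δ (highRow m) = 0
      · rw [hzero _ hi]
        exact mem_solutions_succ.2 ⟨hmemM _, hi⟩
      · have hmem : highRow m ∈ classP Δ e (e (highRow m)) := mem_classP.2 ⟨hi, rfl⟩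
        set j := e (highRow m)
        by_cases his : highRow m = istar j
        · rw [his, hstar' j (his ▸ hhigh m j)]
          exact hcomb _ _ j (hstar j) (hlow j)
        · rw [hother _ j hmem (hhigh m j) his]
          exact hcomb _ _ j hmem (hstar j)
  · obtain ⟨j, rfl⟩ | ⟨m, rfl⟩ := exists_lowRow_or_highRow i
    · rw [hlow', if_pos (hlt j), pivotSwap_of_mem (hlow j), Equiv.swap_apply_left,
        ← pow_one (X : (ZMod (p ^ r))[X])]
      exact ((h.keyed.hasKey _).X_pow_smul 1).unit_smul (Units.isUnit _)
    · rw [if_neg (hnlt m), mul_zero, add_zero]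
      by_cases hi : Δ (highRow m) = 0
      · rw [hzero _ hi, pivotSwap, if_pos hi]
        exact h.keyed.hasKey _
      · have hmem : highRow m ∈ classP Δ e (e (highRow m)) := mem_classP.2 ⟨hi, rfl⟩
        set j := e (highRow m)
        rw [pivotSwap_of_mem hmem]
        by_cases his : highRow m = istar j
        · have hne : istar j ≠ lowRow j := his ▸ hhigh m j
          -- The pivot has the smaller key, so the difference takes the key of row `j`; the sign is
          -- changed to put that row first.
          rw [his, hstar' j hne, Equiv.swap_apply_right, ← neg_sub, ← neg_one_smul (ZMod (p ^ r))]
          exact ((h.keyed.hasKey _).smul_sub_smul (h.keyed.hasKey _)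
            ((hspec j).2 _ (hlow j) hne.symm) (Units.isUnit _)).unit_smul isUnit_one.neg
        · rw [hother _ j hmem (hhigh m j) his, Equiv.swap_apply_of_ne_of_ne (hhigh m j) his]
          exact (h.keyed.hasKey _).smul_sub_smul (h.keyed.hasKey _) ((hspec j).2 _ hmem his)
            (Units.isUnit _)
  · refine (pivotSwap_involutive hlow hstar).injective (h.keyed.inj _ _ ?_)
    simpa only [Nat.ModEq, Nat.add_mul_mod_self_left] using hij
  · obtain ⟨hvk, hve⟩ := mem_solutions_succ.1 hv
    obtain ⟨i, t, rfl⟩ := h.keyed.exists_key v hvk n hn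
    obtain ⟨i', rfl⟩ := (pivotSwap_involutive hlow hstar).surjective i
    obtain ⟨j, rfl⟩ | ⟨m, rfl⟩ := exists_lowRow_or_highRow i'
    · cases t with
      | succ t =>
        refine ⟨lowRow j, t, ?_⟩
        simp only [if_pos (hlt j)]
        ring
      | zero =>
        -- A solution at time `k + 1` with the key of the pivot: subtracting a nonzero digit times
        -- the pivot lowers the key and leaves an error of exact exponent `j`, so some row below the
        -- pivot would have an error not divisible by `p ^ (j + 1)`.
        exfalso
        rw [pivotSwap_of_mem (hlow j), Equiv.swap_apply_left, mul_zero, add_zero] at hn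
        obtain ⟨a, ha, hb⟩ := (h.keyed.hasKey (istar j)).exists_digit hn.1
        have ha0 : a ≠ 0 := by
          rintro rfl
          rw [zero_smul, sub_zero] at hb
          exact hn.2 hb
        have hua := isUnit_of_mem_digits ha ha0
        obtain ⟨l, h1, h2⟩ := h.keyed.exists_not_dvd (a := (p : ZMod (p ^ r)) ^ ((j : ℕ) + 1))
          (φ := lastError S (k + 1)) (fun v hv => lastError_succ_X_smul hv)
          (Submodule.sub_mem _ hvk (IsKeyed.const_smul_mem _ (hmemM (istar j)) a)) hb (by
            rw [map_sub, hve, zero_sub, dvd_neg, map_smul, smul_eq_mul, hua.dvd_mul_left]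
            exact ((mem_classP_iff_exactPow hΔ).1 (hstar j)).2)
        exact absurd ((hspec j).1 l h2) (not_le.2 h1)
    · refine ⟨highRow m, t, ?_⟩
      simp only [if_neg (hnlt m)]
      ring
  · rw [hlow', map_smul, constCoeff₂_X_smul, smul_zero]
  -- The factor `x` delays the pivot's error by one step and division by its unit normalizes it, so
  -- row `j` again has next error `p ^ j`.
  · rw [hlow', map_smul, lastError_X_smul, hval _ j (hstar j), smul_eq_mul, ← mul_assoc,
      Units.inv_mul, one_mul]
  · by_cases hi : Δ (highRow m) = 0
    · rw [hzero _ hi]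
      exact h.const_high m
    · have hmem : highRow m ∈ classP Δ e (e (highRow m)) := mem_classP.2 ⟨hi, rfl⟩
      set j := e (highRow m)
      by_cases his : highRow m = istar j
      · rw [his, hstar' j (his ▸ hhigh m j), map_sub, map_smul, map_smul, h.const_low, smul_zero,
          sub_zero, smul_eq_mul, ExactPow.unit_mul (Units.isUnit _), ← his]
        exact h.const_high m
      · rw [hother _ j hmem (hhigh m j) his, map_sub, map_smul, map_smul, smul_eq_mul,
          sub_eq_add_neg]
        refine ((ExactPow.unit_mul (Units.isUnit _)).2 (h.const_high m)).add_of_dvd ?_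
        rw [dvd_neg, smul_eq_mul]
        refine dvd_mul_of_dvd_right ?_ _
        -- The subtracted pivot has smaller key. If it is a high row, its constant coefficient
        -- therefore has larger exponent and cannot disturb the exact exponent `m`.
        have hKlt := (hspec j).2 _ hmem his
        obtain ⟨l, hl⟩ | ⟨l, hl⟩ := exists_lowRow_or_highRow (istar j)
        · rw [hl, h.const_low]
          exact dvd_zero _
        · rw [hl] at hKlt ⊢
          exact (pow_dvd_pow _ (h.const_high_lt hKlt)).trans (h.const_high l).1

end IsLoopInvariant

theorem exists_isLoopInvariant {N : ℕ} (h : IsState S N k V) : ∃ K, IsLoopInvariant S k V K := by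
  induction h with
  | init => exact ⟨_, isLoopInvariant_init S⟩
  | step k V V' hk _ hstep ih =>
    obtain ⟨K, hK⟩ := ih
    obtain ⟨θ, e, istar, h1, h2, rfl⟩ := hstep
    have hd : discrepancy S N (k + 1) V = fun i => lastError S (k + 1) (V i) :=
      funext fun i => discrepancy_eq hk V i
    rw [hd] at h1 h2 ⊢
    exact ⟨_, hK.step h1 (fun j => (h2 j).1) fun j i hi => ((h2 j).2 i hi).1⟩

/-- Pivots exist because each class `P_j` contains row `j`. -/
theorem IsLoopInvariant.exists_step {N : ℕ} (h : IsLoopInvariant S k V K) (hk : k < N) :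
    ∃ V', IsStep S N (k + 1) V V' := by
  classical
  have hd : discrepancy S N (k + 1) V = fun i => lastError S (k + 1) (V i) :=
    funext fun i => discrepancy_eq hk V i
  have hex : ∀ i : Fin (2 * r), ∃ (u : (ZMod (p ^ r))ˣ) (j : Fin r),
      lastError S (k + 1) (V i) ≠ 0 →
        lastError S (k + 1) (V i) = u * (p : ZMod (p ^ r)) ^ (j : ℕ) := by
    intro i
    by_cases hi : lastError S (k + 1) (V i) = 0
    · exact ⟨1, ⟨0, IsKeyed.pos i⟩, fun h => absurd hi h⟩
    · obtain ⟨u, j, hu⟩ := ZMod.exists_eq_unit_mul_prime_pow hi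
      exact ⟨u, j, fun _ => hu⟩
  choose θ e hΔ using hex
  have hsel : ∀ j, ∃ a ∈ classP (fun i => lastError S (k + 1) (V i)) e j,
      ∀ i ∈ classP (fun i => lastError S (k + 1) (V i)) e j,
        lm (V a) ≤ lm (V i) ∧ (lm (V i) = lm (V a) → i ≤ a) := by
    intro j
    set P := classP (fun i => lastError S (k + 1) (V i)) e j
    obtain ⟨b, hb, hbmin⟩ := Finset.exists_min_image P (fun i => lm (V i)) ⟨_, h.low_mem hΔ j⟩
    obtain ⟨a, ha, hamax⟩ := Finset.exists_max_image (P.filter fun i => lm (V i) = lm (V b)) id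
      ⟨b, Finset.mem_filter.2 ⟨hb, rfl⟩⟩
    rw [Finset.mem_filter] at ha
    refine ⟨a, ha.1, fun i hi => ⟨ha.2 ▸ hbmin i hi, fun hia => ?_⟩⟩
    exact hamax i (Finset.mem_filter.2 ⟨hi, hia.trans ha.2⟩)
  choose istar h1 h2 using hsel
  rw [← hd] at h1 h2
  refine ⟨_, θ, e, istar, ?_, fun j => ⟨h1 j, h2 j⟩, rfl⟩
  rw [hd]
  exact hΔ

theorem exists_isState (S : ℕ → ZMod (p ^ r)) {N : ℕ} (k : ℕ) (hk : k ≤ N) :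
    ∃ V, IsState S N k V := by
  induction k with
  | zero => exact ⟨_, IsState.init⟩
  | succ k ih =>
    obtain ⟨V, hV⟩ := ih (by omega)
    obtain ⟨K, hK⟩ := exists_isLoopInvariant hV
    obtain ⟨V', hV'⟩ := hK.exists_step (N := N) hk
    exact ⟨V', IsState.step k V V' hk hV hV'⟩

end Step

/-! ### Feedback and characteristic polynomials as recurrences. -/

section Recurrences

variable {R : Type*} [CommRing R]

/-- `f` has degree at most `L` and annihilates the windows of length `L + 1` of `S 1, …, S N`. -/
def IsRecurrence (S : ℕ → R) (N L : ℕ) (f : R[X]) : Prop :=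
  f.natDegree ≤ L ∧ ∀ m, L < m → m ≤ N → ∑ i ∈ Finset.range (L + 1), f.coeff i * S (m - i) = 0

theorem sum_range_succ_eq_add_sum_Icc (L : ℕ) (g : ℕ → R) :
    ∑ i ∈ Finset.range (L + 1), g i = g 0 + ∑ i ∈ Finset.Icc 1 L, g i := by
  rw [Finset.range_eq_Ico, Finset.sum_eq_sum_Ico_succ_bot (Nat.succ_pos L)]
  rfl

theorem isFeedbackPoly_iff {S : ℕ → R} {N L : ℕ} {f : R[X]} :
    IsFeedbackPoly S N L f ↔ IsRecurrence S N L f ∧ IsUnit (f.coeff 0) := by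
  constructor
  · rintro ⟨h1, h2, h3⟩
    refine ⟨⟨h1, fun m hm hmN => ?_⟩, h2⟩
    have := h3 (m - L) (by omega) (by omega)
    rw [Nat.add_sub_cancel' hm.le] at this
    rw [sum_range_succ_eq_add_sum_Icc]
    exact this
  · rintro ⟨⟨h1, h3⟩, h2⟩
    refine ⟨h1, h2, fun j hj hjN => ?_⟩
    have := h3 (L + j) (by omega) hjN
    rw [sum_range_succ_eq_add_sum_Icc] at this
    exact this

theorem isCharPoly_iff_reflect {S : ℕ → R} {N : ℕ} {d : R[X]} :
    IsCharPoly S N d ↔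
      IsUnit d.leadingCoeff ∧ IsRecurrence S N d.natDegree (d.reflect d.natDegree) := by
  have hc : ∀ i ≤ d.natDegree, (d.reflect d.natDegree).coeff i = d.coeff (d.natDegree - i) :=
    fun i hi => by rw [coeff_reflect, revAt_le hi]
  have hsum : ∀ m, ∑ i ∈ Finset.range (d.natDegree + 1),
      (d.reflect d.natDegree).coeff i * S (m - i) =
        d.leadingCoeff * S m + ∑ i ∈ Finset.Icc 1 d.natDegree, d.coeff (d.natDegree - i) *
          S (m - i) := by
    intro m
    rw [sum_range_succ_eq_add_sum_Icc, hc 0 (Nat.zero_le _)]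
    congr 1
    refine Finset.sum_congr rfl fun i hi => ?_
    rw [hc i (Finset.mem_Icc.1 hi).2]
  refine and_congr_right fun _ => ?_
  constructor
  · intro h
    refine ⟨natDegree_le_iff_coeff_eq_zero.2 fun i hi => ?_, fun m hm hmN => ?_⟩
    · rw [coeff_reflect, revAt_eq_self_of_lt hi, coeff_eq_zero_of_natDegree_lt hi]
    · rw [hsum, ← h (m - d.natDegree) (by omega) (by omega), Nat.add_sub_cancel' hm.le]
  · intro h j hj hjN
    rw [← hsum]
    exact h.2 _ (by omega) hjN

namespace IsRecurrence

variable {S : ℕ → R} {N L : ℕ} {f : R[X]}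

theorem reflect_reciprocal (h : IsRecurrence S N L f) :
    IsRecurrence (reciprocal S N) N L (f.reflect L) := by
  refine ⟨natDegree_le_iff_coeff_eq_zero.2 fun i hi => ?_, fun m hm hmN => ?_⟩
  · rw [coeff_reflect, revAt_eq_self_of_lt hi,
      coeff_eq_zero_of_natDegree_lt (lt_of_le_of_lt h.1 hi)]
  -- Reversal of time sends the window ending at `m` to the one ending at `N + 1 + L - m`.
  · rw [← h.2 (N + 1 + L - m) (by omega) (by omega), ← Finset.sum_range_reflect]
    refine Finset.sum_congr rfl fun i hi => ?_
    have := Finset.mem_range.1 hi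
    rw [coeff_reflect, revAt_le (by omega), reciprocal]
    congr 2 <;> omega

theorem congr {T : ℕ → R} (h : IsRecurrence S N L f) (hST : ∀ i ≤ N, S i = T i) :
    IsRecurrence T N L f := by
  refine ⟨h.1, fun m hm hmN => ?_⟩
  rw [← h.2 m hm hmN]
  exact Finset.sum_congr rfl fun i _ => by rw [hST _ (by omega)]

theorem reflect_of_reciprocal (h : IsRecurrence (reciprocal S N) N L f) :
    IsRecurrence S N L (f.reflect L) :=
  h.reflect_reciprocal.congr fun i hi => by
    rw [reciprocal, reciprocal]
    congr 1
    omega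

end IsRecurrence

/-- Passing to characteristic polynomials reverses coefficients, and passing to the reciprocal
sequence reverses them again. -/
theorem isCharPoly_reciprocal_iff {S : ℕ → R} {N : ℕ} {d : R[X]} :
    IsCharPoly (reciprocal S N) N d ↔
      IsUnit d.leadingCoeff ∧ IsRecurrence S N d.natDegree d := by
  rw [isCharPoly_iff_reflect]
  refine and_congr_right fun _ => ⟨fun h => ?_, fun h => h.reflect_reciprocal⟩
  have h' := h.reflect_of_reciprocal
  rwa [reflect_reflect] at h'

theorem exists_isFeedbackPoly_reciprocal_iff {S : ℕ → R} {N L : ℕ} :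
    (∃ g, IsFeedbackPoly (reciprocal S N) N L g) ↔
      ∃ f, IsRecurrence S N L f ∧ IsUnit (f.coeff L) := by
  simp only [isFeedbackPoly_iff]
  constructor
  · rintro ⟨g, h1, h2⟩
    refine ⟨_, h1.reflect_of_reciprocal, ?_⟩
    rwa [coeff_reflect, revAt_le le_rfl, Nat.sub_self]
  · rintro ⟨f, h1, h2⟩
    refine ⟨_, h1.reflect_reciprocal, ?_⟩
    rwa [coeff_reflect, revAt_le (Nat.zero_le _), Nat.sub_zero]

end Recurrences

/-! ### Recurrences parametrized by the rows of the invariant. -/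

section Parametrization

variable {p r : ℕ} {S : ℕ → ZMod (p ^ r)} {N L : ℕ}

/-- The first entry is free in degrees up to `L` and absorbs the errors at times `0, …, L`; the
later errors are the recurrence relations. The bound `r * (2 * (L + 1))` says that both entries have
degree at most `L`. -/
theorem isRecurrence_iff {f : (ZMod (p ^ r))[X]} :
    IsRecurrence S N L f ↔
      ∃ v ∈ solutions S N, v ∈ below p r (r * (2 * (L + 1))) ∧ v 1 = f := by
  have herr : ∀ v : Fin 2 → (ZMod (p ^ r))[X], (v 1).natDegree ≤ L → ∀ m, L < m →
      lastError S m v = (v 0).coeff m + ∑ i ∈ Finset.range (L + 1), (v 1).coeff i * S (m - i) := by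
    intro v hv m hm
    rw [lastError_eq_sum, ← Finset.sum_subset (Finset.range_subset_range.2 (Nat.succ_le_of_lt hm))]
    intro i _ hi
    rw [coeff_eq_zero_of_natDegree_lt, zero_mul]
    rw [Finset.mem_range] at hi
    omega
  constructor
  · rintro ⟨h1, h2⟩
    set g : (ZMod (p ^ r))[X] :=
      ∑ m ∈ Finset.range (L + 1), monomial m (lastError S m ![0, f]) with hg
    have hgc : ∀ m, g.coeff m = if m < L + 1 then lastError S m ![0, f] else 0 := by
      intro m
      simp [hg, coeff_monomial]
    refine ⟨![-g, f], mem_solutions.2 fun m hm => ?_, mem_below_mul_iff.2 fun i α hα => ?_, rfl⟩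
    · rcases Nat.lt_or_ge L m with hLm | hLm
      · rw [herr _ h1 m hLm]
        simp only [Matrix.cons_val_zero, Matrix.cons_val_one, coeff_neg]
        rw [hgc, if_neg (by omega), neg_zero, zero_add]
        exact h2 m hLm hm
      · have hgm := hgc m
        rw [if_pos (by omega), lastError_eq_sum] at hgm
        rw [lastError_eq_sum]
        simp only [Matrix.cons_val_zero, Matrix.cons_val_one, coeff_neg, hgm, coeff_zero, zero_add]
        exact neg_add_cancel _
    · have := i.2
      fin_cases i
      · simp only [Fin.zero_eta, Matrix.cons_val_zero, coeff_neg]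
        rw [hgc, if_neg (by simp at hα; omega), neg_zero]
      · exact coeff_eq_zero_of_natDegree_lt (by simp at hα; simp; omega)
  · rintro ⟨v, hv, hvb, rfl⟩
    rw [mem_below_mul_iff] at hvb
    have hdeg : (v 1).natDegree ≤ L := natDegree_le_iff_coeff_eq_zero.2 fun m hm =>
      hvb 1 m (by simp; omega)
    refine ⟨hdeg, fun m hm hmN => ?_⟩
    rw [← mem_solutions.1 hv m hmN, herr v hdeg m hm, hvb 0 m (by simp; omega), zero_add]

theorem smul_mem_below {n K : ℕ} {v : Fin 2 → (ZMod (p ^ r))[X]} (hv : HasKey v K)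
    {c : (ZMod (p ^ r))[X]} (hc : c ≠ 0 → K + 2 * r * c.natDegree < n) :
    c • v ∈ below p r n := by
  by_cases h0 : c = 0
  · rw [h0, zero_smul]
    exact Submodule.zero_mem _
  · rw [c.as_sum_range_C_mul_X_pow, Finset.sum_smul]
    refine Submodule.sum_mem _ fun t ht => ?_
    rw [← smul_smul, C_smul_row]
    refine Submodule.smul_mem _ _ (below_mono ?_ (hv.X_pow_smul t).1)
    have := Nat.mul_le_mul_left (2 * r) (Nat.lt_succ_iff.1 (Finset.mem_range.1 ht))
    have := hc h0
    omega

/-- The polynomials `c i` have coefficients in `A_p` and satisfy `deg (c i) + K i / (2 * r) ≤ L`. -/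
def IsDigitFamily (K : Fin (2 * r) → ℕ) (L : ℕ) (c : Fin (2 * r) → (ZMod (p ^ r))[X]) : Prop :=
  (∀ i n, (c i).coeff n ∈ digits p r) ∧
    ∀ i, c i ≠ 0 → K i + 2 * r * (c i).natDegree < r * (2 * (L + 1))

theorem degree_bound_iff (hr : 0 < r) {k d : ℕ} :
    k + 2 * r * d < r * (2 * (L + 1)) ↔ d + k / (2 * r) ≤ L := by
  have h : r * (2 * (L + 1)) = (L + 1) * (2 * r) := by ring
  rw [← Nat.lt_succ_iff, h, ← Nat.div_lt_iff_lt_mul (by omega),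
    Nat.add_mul_div_left _ _ (by omega), add_comm]

variable {V : Matrix (Fin (2 * r)) (Fin 2) (ZMod (p ^ r))[X]} {K : Fin (2 * r) → ℕ}

theorem paramPoly_eq {m : Fin (2 * r)} {a : ZMod (p ^ r)} {c : Fin (2 * r) → (ZMod (p ^ r))[X]} :
    paramPoly V m a c = (∑ i, Function.update c m (C a) i • V i) 1 := by
  rw [paramPoly, Finset.sum_apply, ← Finset.add_sum_erase _ _ (Finset.mem_univ m),
    Function.update_self]
  congr 1
  refine Finset.sum_congr rfl fun j hj => ?_
  rw [Function.update_of_ne (Finset.ne_of_mem_erase hj)]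
  rfl

theorem IsAdmissible.isDigitFamily [hp : Fact p.Prime] (hr : 0 < r)
    (hK : ∀ i, HasKey (V i) (K i)) {m : Fin (2 * r)} {a : ZMod (p ^ r)}
    {c : Fin (2 * r) → (ZMod (p ^ r))[X]} (h : IsAdmissible V m a c) :
    IsDigitFamily K (topDeg (V m)) (Function.update c m (C a)) := by
  refine ⟨fun i n => ?_, fun i hi => ?_⟩
  · rcases eq_or_ne i m with rfl | him
    · rw [Function.update_self, coeff_C]
      split_ifs
      exacts [h.1.1, zero_mem_digits]
    · rw [Function.update_of_ne him]
      exact (h.2 i him).1 n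
  · rw [degree_bound_iff hr, ← (hK i).topDeg_eq hr]
    rcases eq_or_ne i m with rfl | him
    · rw [Function.update_self, natDegree_C, zero_add]
    · rw [Function.update_of_ne him] at hi ⊢
      exact (h.2 i him).2 hi

theorem mem_paramSet_iff [hp : Fact p.Prime] (hr : 0 < r) (hK : ∀ i, HasKey (V i) (K i))
    {m : Fin (2 * r)} {f : (ZMod (p ^ r))[X]} :
    f ∈ paramSet V m ↔ ∃ c : Fin (2 * r) → (ZMod (p ^ r))[X],
      IsDigitFamily K (topDeg (V m)) c ∧ (c m).coeff 0 ≠ 0 ∧ f = (∑ i, c i • V i) 1 := by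
  constructor
  · rintro ⟨a, c, h, rfl⟩
    refine ⟨_, h.isDigitFamily hr hK, ?_, paramPoly_eq⟩
    rw [Function.update_self, coeff_C_zero]
    exact h.1.2
  · rintro ⟨c, h, hm, rfl⟩
    have hdeg : ∀ i, c i ≠ 0 → (c i).natDegree + topDeg (V i) ≤ topDeg (V m) := fun i hi => by
      rw [(hK i).topDeg_eq hr, ← degree_bound_iff hr]
      exact h.2 i hi
    have hcm : C ((c m).coeff 0) = c m := by
      refine (eq_C_of_natDegree_eq_zero ?_).symm
      -- The degree bound at index `m` itself leaves only a constant, which is the parameter `a`.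
      have := hdeg m fun h0 => hm (by rw [h0, coeff_zero])
      omega
    refine ⟨(c m).coeff 0, c, ⟨⟨h.1 m 0, hm⟩, fun j _ => ⟨h.1 j, hdeg j⟩⟩, ?_⟩
    rw [paramPoly_eq, hcm, Function.update_eq_self]

namespace IsLoopInvariant

theorem isDigitFamily_mem (h : IsLoopInvariant S N V K) {c : Fin (2 * r) → (ZMod (p ^ r))[X]}
    (hc : IsDigitFamily K L c) :
    ∑ i, c i • V i ∈ solutions S N ∧ ∑ i, c i • V i ∈ below p r (r * (2 * (L + 1))) :=
  ⟨Submodule.sum_mem _ fun i _ => Submodule.smul_mem _ _ (h.keyed.mem i),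
    Submodule.sum_mem _ fun i _ => smul_mem_below (h.keyed.hasKey i) (hc.2 i)⟩

theorem isRecurrence_row (h : IsLoopInvariant S N V K) (hr : 0 < r) (i : Fin (2 * r)) :
    V i ∈ below p r (r * (2 * (topDeg (V i) + 1))) ∧
      IsRecurrence S N (topDeg (V i)) (V i 1) := by
  have hb : V i ∈ below p r (r * (2 * (topDeg (V i) + 1))) := by
    refine below_mono ?_ (h.keyed.hasKey i).1
    have := (degree_bound_iff hr (L := topDeg (V i)) (k := K i) (d := 0)).2
      (by rw [(h.keyed.hasKey i).topDeg_eq hr, zero_add])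
    rwa [mul_zero, add_zero] at this
  exact ⟨hb, isRecurrence_iff.2 ⟨V i, h.keyed.mem i, hb, rfl⟩⟩

end IsLoopInvariant

variable [hp : Fact p.Prime]

/-- The largest key possible in degree at most `L` belongs to leading monomial `x ^ L e_2` with a
coefficient of full order. -/
theorem hasKey_iff_isUnit_coeff (hr : 0 < r) {v : Fin 2 → (ZMod (p ^ r))[X]}
    (hv : v ∈ below p r (r * (2 * (L + 1)))) :
    HasKey v (r * (2 * (L + 1)) - 1) ↔ IsUnit ((v 1).coeff L) := by
  have hpos : 0 < r * (2 * (L + 1)) := by positivity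
  have hK : r * (2 * (L + 1)) - 1 = r * (2 * L + 1) + (r - 1) := by
    have : r * (2 * (L + 1)) = r * (2 * L + 1) + r := by ring
    omega
  rw [ZMod.isUnit_iff_prime_pow_mul_ne_zero hr]
  constructor
  · intro h
    obtain ⟨i, α, h1, h2⟩ := h.lead
    rw [hK, Nat.mul_add_div hr, Nat.div_eq_of_lt (by omega)] at h1
    rw [hK, Nat.mul_add_mod, Nat.mod_eq_of_lt (by omega)] at h2
    have := i.2
    obtain rfl : i = 1 := Fin.ext (by simp; omega)
    obtain rfl : α = L := by simp at h1; omega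
    exact h2
  · intro h
    refine ⟨by rwa [Nat.sub_add_cancel hpos], fun h' => h ?_⟩
    have := h' 1 L
    rwa [hK, Fin.val_one, Nat.add_sub_cancel_left] at this

namespace IsLoopInvariant

theorem isRecurrence_iff_isDigitFamily (h : IsLoopInvariant S N V K) {f : (ZMod (p ^ r))[X]} :
    IsRecurrence S N L f ↔ ∃ c : Fin (2 * r) → (ZMod (p ^ r))[X],
      IsDigitFamily K L c ∧ f = (∑ i, c i • V i) 1 := by
  rw [isRecurrence_iff]
  constructor
  · rintro ⟨v, hv, hvb, rfl⟩
    obtain ⟨c, h1, h2, rfl⟩ := h.keyed.exists_expansion _ v hv hvb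
    exact ⟨c, ⟨h1, h2⟩, rfl⟩
  · rintro ⟨c, hc, rfl⟩
    exact ⟨_, (h.isDigitFamily_mem hc).1, (h.isDigitFamily_mem hc).2, rfl⟩

/-- Modulo `p`, every row except `r + 1` has zero constant coefficient in its second entry, and a
nonzero digit is a unit. -/
theorem isUnit_coeff_zero_iff (h : IsLoopInvariant S N V K) (hr : 0 < r)
    {c : Fin (2 * r) → (ZMod (p ^ r))[X]} (hc : IsDigitFamily K L c) :
    IsUnit (((∑ i, c i • V i) 1).coeff 0) ↔ (c (midRow hr)).coeff 0 ≠ 0 := by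
  have hmid : midRow hr = highRow ⟨0, hr⟩ := rfl
  change IsUnit (constCoeff₂ (∑ i, c i • V i)) ↔ _
  rw [map_sum, ← Finset.add_sum_erase _ _ (Finset.mem_univ (midRow hr)),
    IsKeyed.map_smul_eq (fun v _ => constCoeff₂_X_smul v) (h.keyed.mem _)]
  have hrest : (p : ZMod (p ^ r)) ^ (0 + 1) ∣
      ∑ i ∈ Finset.univ.erase (midRow hr), constCoeff₂ (c i • V i) := by
    refine Finset.dvd_sum fun i hi => ?_
    rw [IsKeyed.map_smul_eq (fun v _ => constCoeff₂_X_smul v) (h.keyed.mem _)]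
    refine dvd_mul_of_dvd_right ?_ _
    obtain ⟨j, rfl⟩ | ⟨j, rfl⟩ := exists_lowRow_or_highRow i
    · rw [h.const_low]
      exact dvd_zero _
    · refine (pow_dvd_pow _ ?_).trans (h.const_high j).1
      by_contra hj
      refine Finset.ne_of_mem_erase hi ?_
      rw [hmid]
      congr 1
      exact Fin.ext (by simp; omega)
  rw [← ExactPow.zero_iff hr]
  constructor
  · intro hu h0
    rw [h0, zero_mul, zero_add] at hu
    exact hu.2 hrest
  · intro h0
    refine ExactPow.add_of_dvd ?_ hrest
    rw [ExactPow.unit_mul (isUnit_of_mem_digits (hc.1 _ 0) h0), hmid]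
    exact h.const_high ⟨0, hr⟩

theorem isFeedbackPoly_iff (h : IsLoopInvariant S N V K) (hr : 0 < r)
    {f : (ZMod (p ^ r))[X]} :
    IsFeedbackPoly S N L f ↔
      ∃ c : Fin (2 * r) → (ZMod (p ^ r))[X],
        IsDigitFamily K L c ∧ (c (midRow hr)).coeff 0 ≠ 0 ∧ f = (∑ i, c i • V i) 1 := by
  rw [_root_.isFeedbackPoly_iff, h.isRecurrence_iff_isDigitFamily]
  constructor
  · rintro ⟨⟨c, hc, rfl⟩, hu⟩
    exact ⟨c, hc, (h.isUnit_coeff_zero_iff hr hc).1 hu, rfl⟩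
  · rintro ⟨c, hc, h0, rfl⟩
    exact ⟨⟨c, hc, rfl⟩, (h.isUnit_coeff_zero_iff hr hc).2 h0⟩

theorem complexity_eq (h : IsLoopInvariant S N V K) (hr : 0 < r) :
    complexity S N = topDeg (V (midRow hr)) ∧
      IsFeedbackPoly S N (topDeg (V (midRow hr))) (V (midRow hr) 1) := by
  have hf : IsFeedbackPoly S N (topDeg (V (midRow hr))) (V (midRow hr) 1) :=
    _root_.isFeedbackPoly_iff.2 ⟨(h.isRecurrence_row hr _).2,
      (ExactPow.zero_iff hr).1 (h.const_high ⟨0, hr⟩)⟩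
  refine ⟨le_antisymm (Nat.sInf_le ⟨_, hf⟩) (le_csInf ⟨_, _, hf⟩ ?_), hf⟩
  rintro L ⟨f, hL⟩
  obtain ⟨c, hc, h0, -⟩ := (h.isFeedbackPoly_iff hr).1 hL
  have := (degree_bound_iff hr).1 (hc.2 _ fun h' => h0 (by rw [h', coeff_zero]))
  rw [(h.keyed.hasKey _).topDeg_eq hr]
  omega

/-- The `2 * r` keys are incongruent, so they represent every residue modulo `2 * r` once, including
`2 * r - 1`. -/
theorem existsUnique_lead (h : IsLoopInvariant S N V K) (hr : 0 < r) :
    ∃! j : Fin (2 * r), lpos (V j) = 1 ∧ HasOrder p r (V j) := by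
  have h2r : 0 < 2 * r := by omega
  let g : Fin (2 * r) → Fin (2 * r) := fun i => ⟨K i % (2 * r), Nat.mod_lt _ h2r⟩
  have hg : Function.Injective g := fun i j hij => h.keyed.inj i j (Fin.mk.inj_iff.1 hij)
  obtain ⟨j, hj⟩ := Finite.surjective_of_injective hg ⟨2 * r - 1, by omega⟩
  refine ⟨j, ((h.keyed.hasKey j).mod_eq hr).1 (Fin.mk.inj_iff.1 hj), fun i hi => hg ?_⟩
  rw [hj]
  exact Fin.ext (((h.keyed.hasKey i).mod_eq hr).2 hi)

variable {jstar : Fin (2 * r)}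

theorem key_lead (h : IsLoopInvariant S N V K) (hr : 0 < r)
    (hj : lpos (V jstar) = 1 ∧ HasOrder p r (V jstar)) :
    K jstar = r * (2 * (topDeg (V jstar) + 1)) - 1 := by
  have hmod := ((h.keyed.hasKey jstar).mod_eq hr).2 hj
  have hdm := Nat.div_add_mod (K jstar) (2 * r)
  rw [← (h.keyed.hasKey jstar).topDeg_eq hr, hmod] at hdm
  have : r * (2 * (topDeg (V jstar) + 1)) = 2 * r * topDeg (V jstar) + 2 * r := by ring
  omega

/-- The key of row `jstar` is the maximum allowed in this degree. The terms of the other rows are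
incongruent to it, hence strictly below, so the top layer is decided by the digit at `jstar`. -/
theorem isUnit_coeff_iff (h : IsLoopInvariant S N V K) (hr : 0 < r)
    (hj : lpos (V jstar) = 1 ∧ HasOrder p r (V jstar)) {c : Fin (2 * r) → (ZMod (p ^ r))[X]}
    (hc : IsDigitFamily K (topDeg (V jstar)) c) :
    IsUnit (((∑ i, c i • V i) 1).coeff (topDeg (V jstar))) ↔ (c jstar).coeff 0 ≠ 0 := by
  have hkey := h.key_lead hr hj
  rw [← hasKey_iff_isUnit_coeff hr (h.isDigitFamily_mem hc).2, ← hkey,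
    ← Finset.add_sum_erase _ _ (Finset.mem_univ jstar)]
  have hpos : 0 < r * (2 * (topDeg (V jstar) + 1)) := by positivity
  have hrest : ∑ i ∈ Finset.univ.erase jstar, c i • V i ∈ below p r (K jstar) := by
    refine Submodule.sum_mem _ fun i hi => smul_mem_below (h.keyed.hasKey i) fun hci => ?_
    have h1 := hc.2 i hci
    have h2 : K i + 2 * r * (c i).natDegree ≠ K jstar := fun heq =>
      Finset.ne_of_mem_erase hi (h.keyed.inj _ _ (by
        rw [← heq, Nat.ModEq, Nat.add_mul_mod_self_left]))
    omega
  have hconst : c jstar = C ((c jstar).coeff 0) := by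
    by_cases h0 : c jstar = 0
    · rw [h0, coeff_zero, C_0]
    · refine eq_C_of_natDegree_eq_zero ?_
      have := (degree_bound_iff hr).1 (hc.2 _ h0)
      rw [← (h.keyed.hasKey _).topDeg_eq hr] at this
      omega
  constructor
  · intro hk h0
    rw [hconst, h0, C_0, zero_smul, zero_add] at hk
    exact hk.2 hrest
  · intro h0
    refine HasKey.add_mem ?_ hrest
    rw [hconst, C_smul_row]
    exact (h.keyed.hasKey _).unit_smul (isUnit_of_mem_digits (hc.1 _ 0) h0)

/-- A unit coefficient at `x ^ L` forces a key congruent to `-1` modulo `2 * r`, and such a key can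
only come from row `jstar` times a power of `x`. -/
theorem topDeg_le_of_isRecurrence (h : IsLoopInvariant S N V K) (hr : 0 < r)
    (hj : lpos (V jstar) = 1 ∧ HasOrder p r (V jstar)) {d : (ZMod (p ^ r))[X]}
    (hd : IsRecurrence S N L d) (hu : IsUnit (d.coeff L)) : topDeg (V jstar) ≤ L := by
  obtain ⟨v, hv, hvb, rfl⟩ := isRecurrence_iff.1 hd
  obtain ⟨i, t, hit⟩ := h.keyed.exists_key v hv _ ((hasKey_iff_isUnit_coeff hr hvb).2 hu)
  have hmod : (r * (2 * (L + 1)) - 1) % (2 * r) = 2 * r - 1 := by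
    have : r * (2 * (L + 1)) - 1 = 2 * r * L + (2 * r - 1) := by
      have : r * (2 * (L + 1)) = 2 * r * L + 2 * r := by ring
      omega
    rw [this, Nat.mul_add_mod, Nat.mod_eq_of_lt (by omega)]
  rw [hit, Nat.add_mul_mod_self_left] at hmod
  obtain rfl : i = jstar := h.keyed.inj _ _
    (hmod.trans (((h.keyed.hasKey jstar).mod_eq hr).2 hj).symm)
  have hpos : 0 < r * (2 * (L + 1)) := by positivity
  have := (degree_bound_iff hr (L := L) (k := K i) (d := t)).1 (by omega)
  rw [(h.keyed.hasKey i).topDeg_eq hr]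
  omega

theorem mem_paramSet_lead_iff (h : IsLoopInvariant S N V K) (hr : 0 < r)
    (hj : lpos (V jstar) = 1 ∧ HasOrder p r (V jstar)) {d : (ZMod (p ^ r))[X]} :
    d ∈ paramSet V jstar ↔
      IsRecurrence S N (topDeg (V jstar)) d ∧ IsUnit (d.coeff (topDeg (V jstar))) := by
  rw [mem_paramSet_iff hr h.keyed.hasKey, h.isRecurrence_iff_isDigitFamily]
  constructor
  · rintro ⟨c, hc, h0, rfl⟩
    exact ⟨⟨c, hc, rfl⟩, (h.isUnit_coeff_iff hr hj hc).2 h0⟩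
  · rintro ⟨⟨c, hc, rfl⟩, hu⟩
    exact ⟨c, hc, (h.isUnit_coeff_iff hr hj hc).1 hu, rfl⟩

theorem isRecurrence_lead (h : IsLoopInvariant S N V K) (hr : 0 < r)
    (hj : lpos (V jstar) = 1 ∧ HasOrder p r (V jstar)) :
    IsRecurrence S N (topDeg (V jstar)) (V jstar 1) ∧
      IsUnit ((V jstar 1).coeff (topDeg (V jstar))) := by
  refine ⟨(h.isRecurrence_row hr jstar).2, ?_⟩
  rw [← hasKey_iff_isUnit_coeff hr (h.isRecurrence_row hr jstar).1, ← h.key_lead hr hj]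
  exact h.keyed.hasKey jstar

theorem complexity_reciprocal_eq (h : IsLoopInvariant S N V K) (hr : 0 < r)
    (hj : lpos (V jstar) = 1 ∧ HasOrder p r (V jstar)) :
    complexity (reciprocal S N) N = topDeg (V jstar) := by
  have hmem : topDeg (V jstar) ∈ {L | ∃ f, IsFeedbackPoly (reciprocal S N) N L f} :=
    exists_isFeedbackPoly_reciprocal_iff.2 ⟨_, h.isRecurrence_lead hr hj⟩
  refine le_antisymm (Nat.sInf_le hmem) (le_csInf ⟨_, hmem⟩ fun L hL => ?_)
  obtain ⟨f, h1, h2⟩ := exists_isFeedbackPoly_reciprocal_iff.1 hL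
  exact h.topDeg_le_of_isRecurrence hr hj h1 h2

theorem isMinCharPoly_reciprocal_iff (h : IsLoopInvariant S N V K) (hr : 0 < r)
    (hj : lpos (V jstar) = 1 ∧ HasOrder p r (V jstar)) {d : (ZMod (p ^ r))[X]} :
    IsMinCharPoly (reciprocal S N) N d ↔
      IsRecurrence S N (topDeg (V jstar)) d ∧ IsUnit (d.coeff (topDeg (V jstar))) := by
  -- Needed so that a unit coefficient is nonzero and fixes the degree.
  have : Nontrivial (ZMod (p ^ r)) :=
    ZMod.nontrivial_iff.2 (Nat.one_lt_pow hr.ne' hp.out.one_lt).ne'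
  have hchar : ∀ d : (ZMod (p ^ r))[X], IsRecurrence S N (topDeg (V jstar)) d →
      IsUnit (d.coeff (topDeg (V jstar))) →
      d.natDegree = topDeg (V jstar) ∧ IsCharPoly (reciprocal S N) N d := by
    intro d h1 h2
    have hdeg := le_antisymm h1.1 (le_natDegree_of_ne_zero h2.ne_zero)
    rw [← hdeg] at h1 h2
    exact ⟨hdeg, isCharPoly_reciprocal_iff.2 ⟨h2, h1⟩⟩
  have hle : ∀ d : (ZMod (p ^ r))[X], IsCharPoly (reciprocal S N) N d →
      topDeg (V jstar) ≤ d.natDegree := by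
    intro d hd
    rw [isCharPoly_reciprocal_iff] at hd
    exact h.topDeg_le_of_isRecurrence hr hj hd.2 hd.1
  have hlead := h.isRecurrence_lead hr hj
  constructor
  · rintro ⟨h1, h2⟩
    have hdeg : d.natDegree = topDeg (V jstar) := by
      refine le_antisymm ?_ (hle d h1)
      have := hchar _ hlead.1 hlead.2
      rw [← this.1]
      exact h2 _ this.2
    rw [isCharPoly_reciprocal_iff] at h1
    rw [← hdeg]
    exact ⟨h1.2, h1.1⟩
  · rintro ⟨h1, h2⟩
    obtain ⟨hdeg, hc⟩ := hchar d h1 h2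
    exact ⟨hc, fun d' hd' => hdeg ▸ hle d' hd'⟩

end IsLoopInvariant

end Parametrization

end

/-! ### Assembly of the theorem. -/

theorem mainTheorem1 (p r N : ℕ) (hp : p.Prime) (hr : 0 < r) (S : ℕ → ZMod (p ^ r)) :
    (∃ V : Matrix (Fin (2 * r)) (Fin 2) (ZMod (p ^ r))[X], IsOutput S N V) ∧
    ∀ V : Matrix (Fin (2 * r)) (Fin 2) (ZMod (p ^ r))[X], IsOutput S N V →
      (complexity S N = topDeg (V (midRow hr)) ∧
        IsShortestFeedbackPoly S N (V (midRow hr) 1) ∧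
        {f | IsShortestFeedbackPoly S N f} = paramSet V (midRow hr)) ∧
      (∃! j : Fin (2 * r), lpos (V j) = 1 ∧ HasOrder p r (V j)) ∧
      ∀ jstar : Fin (2 * r), lpos (V jstar) = 1 ∧ HasOrder p r (V jstar) →
        complexity (reciprocal S N) N = topDeg (V jstar) ∧
        IsMinCharPoly (reciprocal S N) N (V jstar 1) ∧
        {d | IsMinCharPoly (reciprocal S N) N d} = paramSet V jstar ∧
        (jstar = midRow hr →
          IsBidirectional S N (V jstar 1) ∧
          {d | IsMinCharPoly (reciprocal S N) N d ∧ IsBidirectional S N d} = paramSet V jstar) ∧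
        (jstar ≠ midRow hr →
          ∀ (a : ZMod (p ^ r)) (c : Fin (2 * r) → (ZMod (p ^ r))[X]),
            IsAdmissible V jstar a c → (c (midRow hr)).coeff 0 ≠ 0 →
            IsMinCharPoly (reciprocal S N) N (paramPoly V jstar a c) ∧
              IsBidirectional S N (paramPoly V jstar a c)) := by
  have : Fact p.Prime := ⟨hp⟩
  refine ⟨exists_isState S N le_rfl, fun V hV => ?_⟩
  obtain ⟨K, h⟩ := exists_isLoopInvariant hV
  obtain ⟨hcomp, hmid⟩ := h.complexity_eq hr
  refine ⟨⟨hcomp, ?_, ?_⟩, h.existsUnique_lead hr, fun jstar hj => ?_⟩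
  · rwa [IsShortestFeedbackPoly, hcomp]
  · ext f
    rw [Set.mem_ofPred_eq, IsShortestFeedbackPoly, hcomp, h.isFeedbackPoly_iff hr,
      mem_paramSet_iff hr h.keyed.hasKey]
  have hset : ∀ d, IsMinCharPoly (reciprocal S N) N d ↔ d ∈ paramSet V jstar := fun d => by
    rw [h.isMinCharPoly_reciprocal_iff hr hj, h.mem_paramSet_lead_iff hr hj]
  have hlead := h.isRecurrence_lead hr hj
  refine ⟨h.complexity_reciprocal_eq hr hj, (h.isMinCharPoly_reciprocal_iff hr hj).2 hlead,
    Set.ext hset, fun hjm => ⟨?_, ?_⟩, fun hjm a c hc h0 => ?_⟩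
  · exact ⟨topDeg (V jstar), by rw [hjm]; exact hmid, hlead.2⟩
  · ext d
    rw [Set.mem_ofPred_eq, hset]
    refine and_iff_left_of_imp fun hd => ⟨topDeg (V jstar), ?_,
      ((h.mem_paramSet_lead_iff hr hj).1 hd).2⟩
    -- When the two distinguished rows coincide, the condition `a ≠ 0` is also the condition for a
    -- unit constant coefficient.
    rw [h.isFeedbackPoly_iff hr, ← hjm, ← mem_paramSet_iff hr h.keyed.hasKey]
    exact hd
  · have hd : paramPoly V jstar a c ∈ paramSet V jstar := ⟨a, c, hc, rfl⟩
    refine ⟨(hset _).2 hd, topDeg (V jstar), ?_, ((h.mem_paramSet_lead_iff hr hj).1 hd).2⟩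
    rw [h.isFeedbackPoly_iff hr]
    refine ⟨_, hc.isDigitFamily hr h.keyed.hasKey, ?_, paramPoly_eq⟩
    rwa [Function.update_of_ne hjm.symm]
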